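/- Let $\mu^-<\mu^+$ be real numbers and let $P$ be a continuous map from $(0,+\infty)$ to the real symmetric $2\times 2$ matrices such that: (1) there is $q_\infty\ge 1$ with $\lim_{x\to+\infty}P(x)=P_\infty:=\begin{pmatrix}\mu^-&0\\0&\mu^+\end{pmatrix}$ and $\int_1^{+\infty}\|P(x)-P_\infty\|^{q_\infty}\,dx<+\infty$; (2) there are $\beta\ge 1$, a real symmetric matrix $P^*$ and $q_0\ge 1$ with $\lim_{x\to 0^+}x^\beta P(x)=P^*$ and $\int_0^1 x^{-\beta}\,\|x^\beta P(x)-P^*\|^{q_0}\,dx<+\infty$; (3) $\det P^*<-1/4$ if $\beta=1$, and $\det P^*<0$ if $\beta>1$. Let $J=\begin{pmatrix}0&1\\-1&0\end{pmatrix}$ and $\tau z=Jz'+P(x)z$, and let $A_0$ be the operator in $L^2((0,+\infty),\mathbb R^2)$ with domain $D(A_0)=\{z\in L^2:\ z \text{ locally absolutely continuous on } (0,+\infty),\ \tau z\in L^2\}$ and $A_0z=\tau z$. Let $\lambda\in(\mu^-,\mu^+)$. Consider the nontrivial solutions $z$ of $\tau z=\lambda z$ on $(0,+\infty)$ (locally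 absolutely continuous, equation a.e.) with $z(x)\to 0$ as $x\to 0^+$, and the continuous functions $\vartheta:(0,+\infty)\to\mathbb R$ with $z=\|z\|(\cos\vartheta,\sin\vartheta)$ whose limit $\vartheta(0)=\lim_{x\to0^+}\vartheta(x)$ exists and lies in $[0,\pi)$. Such $z$ and $\vartheta$ exist, and there is a real number $\nu(\lambda)$ such that $\lim_{x\to+\infty}\vartheta(x)=\nu(\lambda)$ for every choice of them. Moreover, $\lambda$ is an eigenvalue of $A_0$ if and only if $$\nu(\lambda)=\pi-\arctan\sqrt{\frac{\lambda-\mu^-}{\mu^+-\lambda}}\pmod \pi .$$ -/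

import Mathlib

open Filter Topology MeasureTheory Set

namespace DiracSystem

/-- The Euclidean plane `ℝ²`, in which `z = (u, v)` takes its values. -/
abbrev Plane : Type := EuclideanSpace ℝ (Fin 2)

/-- The real Hilbert space `L²((0, ∞), ℝ²)`. -/
abbrev L2 : Type := Lp Plane 2 (volume.restrict (Ioi (0 : ℝ)))

/-- The symplectic matrix `J`. -/
def J : Matrix (Fin 2) (Fin 2) ℝ := !![0, 1; -1, 0]

section Coefficients

open scoped Matrix.Norms.Elementwise

/-- The class of coefficients `P` attached to `μ⁻ < μ⁺`. Only the values `P x` with `x > 0` matter.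
The norm on matrices is the maximum of the absolute values of the entries. -/
structure CoefficientClass (μm μp : ℝ) (P : ℝ → Matrix (Fin 2) (Fin 2) ℝ) : Prop where
  continuousOn : ContinuousOn P (Ioi 0)
  symm : ∀ x, 0 < x → (P x).IsSymm
  /-- Behaviour at infinity. -/
  at_infinity : ∃ q : ℝ, 1 ≤ q ∧
    Tendsto P atTop (𝓝 !![μm, 0; 0, μp]) ∧
    IntegrableOn (fun x => ‖P x - !![μm, 0; 0, μp]‖ ^ q) (Ioi 1)
  /-- Behaviour at zero, with the determinant condition on the limit matrix. -/
  at_zero : ∃ (β : ℝ) (Pstar : Matrix (Fin 2) (Fin 2) ℝ) (q : ℝ),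
    1 ≤ β ∧ Pstar.IsSymm ∧ 1 ≤ q ∧
    Tendsto (fun x : ℝ => x ^ β • P x) (𝓝[>] 0) (𝓝 Pstar) ∧
    IntegrableOn (fun x : ℝ => 1 / x ^ β * ‖x ^ β • P x - Pstar‖ ^ q) (Ioo 0 1) ∧
    (β = 1 → Pstar.det < -1 / 4) ∧
    (1 < β → Pstar.det < 0)

end Coefficients

/-- Local absolute continuity on `(0, ∞)`. -/
def LocAC (z : ℝ → Plane) : Prop :=
  ∀ a b : ℝ, 0 < a → a ≤ b → AbsolutelyContinuousOnInterval z a b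

/-- The differential expression `τ z = J z' + P z`. -/
noncomputable def tau (P : ℝ → Matrix (Fin 2) (Fin 2) ℝ) (z : ℝ → Plane) (x : ℝ) : Plane :=
  Matrix.toLpLin 2 2 J (deriv z x) + Matrix.toLpLin 2 2 (P x) (z x)

/-- `z` is a solution of `J z' + P z = lam z` on `(0, ∞)`. -/
def IsSolution (P : ℝ → Matrix (Fin 2) (Fin 2) ℝ) (lam : ℝ) (z : ℝ → Plane) : Prop :=
  LocAC z ∧ ∀ᵐ x ∂(volume.restrict (Ioi (0 : ℝ))), tau P z x = lam • z x

/-! ### The operator `A₀` -/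

theorem LocAC.continuousOn {z : ℝ → Plane} (hz : LocAC z) : ContinuousOn z (Ioi 0) := by
  intro x hx
  have hx' : (0 : ℝ) < x := hx
  have h := (hz (x / 2) (x + 1) (by linarith) (by linarith)).continuousOn
  rw [uIcc_of_le (by linarith)] at h
  exact (h.continuousAt (Icc_mem_nhds (by linarith) (by linarith))).continuousWithinAt

theorem LocAC.ae_differentiableAt {z : ℝ → Plane} (hz : LocAC z) :
    ∀ᵐ x ∂(volume.restrict (Ioi (0 : ℝ))), DifferentiableAt ℝ z x := by
  have h1 : ∀ n : ℕ, ∀ᵐ x : ℝ, x ∈ uIcc (1 / ((n : ℝ) + 1)) (n + 1) →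
      DifferentiableAt ℝ z x := fun n => by
    have hpos : (0 : ℝ) < 1 / ((n : ℝ) + 1) := by positivity
    refine (hz _ _ hpos ?_).boundedVariationOn.ae_differentiableAt_of_mem_uIcc
    rw [div_le_iff₀ (by positivity)]
    have : (0 : ℝ) ≤ n := n.cast_nonneg
    nlinarith
  rw [ae_restrict_iff' measurableSet_Ioi]
  filter_upwards [ae_all_iff.2 h1] with x hx hx0
  have hx0' : (0 : ℝ) < x := hx0
  obtain ⟨n, hn⟩ := exists_nat_gt (max x (1 / x))
  have hnx : x < n := (le_max_left _ _).trans_lt hn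
  have hnx' : 1 / x < n := (le_max_right _ _).trans_lt hn
  refine hx n (Icc_subset_uIcc ⟨?_, by linarith⟩)
  rw [div_le_iff₀ (by linarith)]
  rw [div_lt_iff₀ hx0'] at hnx'
  nlinarith

theorem LocAC.add {z w : ℝ → Plane} (hz : LocAC z) (hw : LocAC w) : LocAC (z + w) :=
  fun a b ha hab => (hz a b ha hab).add (hw a b ha hab)

theorem LocAC.smul {z : ℝ → Plane} (c : ℝ) (hz : LocAC z) : LocAC (c • z) :=
  fun a b ha hab => (hz a b ha hab).const_smul c

/-- The graph of `A₀`: the pairs `(f, g)` in `L² × L²` such that `f` has a locally absolutely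
continuous representative `z` with `τ z = g` almost everywhere. -/
noncomputable def graphA0 (P : ℝ → Matrix (Fin 2) (Fin 2) ℝ) : Submodule ℝ (L2 × L2) where
  carrier := {p | ∃ z : ℝ → Plane, LocAC z ∧
    p.1 =ᵐ[volume.restrict (Ioi (0 : ℝ))] z ∧
    p.2 =ᵐ[volume.restrict (Ioi (0 : ℝ))] tau P z}
  add_mem' := by
    rintro ⟨f, g⟩ ⟨f', g'⟩ ⟨z, hz, h1, h2⟩ ⟨z', hz', h1', h2'⟩
    refine ⟨z + z', hz.add hz', ?_, ?_⟩
    · exact (Lp.coeFn_add f f').trans (h1.add h1')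
    · filter_upwards [Lp.coeFn_add g g', h2, h2', hz.ae_differentiableAt,
        hz'.ae_differentiableAt] with x hx ha hb hd hd'
      simp only [Prod.mk_add_mk, hx, Pi.add_apply, ha, hb, tau, deriv_add hd hd', map_add]
      abel
  zero_mem' := by
    have h0 : LocAC 0 := fun a b _ _ => by
      rw [absolutelyContinuousOnInterval_iff]
      intro ε hε
      exact ⟨1, one_pos, fun E _ _ => by simpa using hε⟩
    refine ⟨0, h0, Lp.coeFn_zero _ _ _, ?_⟩
    filter_upwards [Lp.coeFn_zero Plane 2 (volume.restrict (Ioi (0 : ℝ)))] with x hx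
    have hd : deriv (0 : ℝ → Plane) x = 0 := deriv_const x (0 : Plane)
    simp only [Prod.snd_zero, hx, tau, hd, Pi.zero_apply, map_zero, add_zero]
  smul_mem' := by
    rintro c ⟨f, g⟩ ⟨z, hz, h1, h2⟩
    refine ⟨c • z, hz.smul c, ?_, ?_⟩
    · exact (Lp.coeFn_smul c f).trans (h1.const_smul c)
    · filter_upwards [Lp.coeFn_smul c g, h2, hz.ae_differentiableAt] with x hx ha hd
      simp only [Prod.smul_mk, hx, Pi.smul_apply, ha, tau, deriv_const_smul c hd, map_smul,
        smul_add]

/-- The operator `A₀` in `L²((0, ∞), ℝ²)`: its domain consists of the `z ∈ L²` that are locally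
absolutely continuous on `(0, ∞)` with `τ z ∈ L²`, and `A₀ z = τ z`. -/
noncomputable def A0 (P : ℝ → Matrix (Fin 2) (Fin 2) ℝ) : L2 →ₗ.[ℝ] L2 :=
  (graphA0 P).toLinearPMap

/-- The relation defining `A₀` is single-valued. -/
theorem graphA0_single (P : ℝ → Matrix (Fin 2) (Fin 2) ℝ) (p : L2 × L2) (hp : p ∈ graphA0 P)
    (h0 : p.1 = 0) : p.2 = 0 := by
  obtain ⟨z, hz, h1, h2⟩ := hp
  have hz0 : z =ᵐ[volume.restrict (Ioi (0 : ℝ))] 0 := by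
    refine h1.symm.trans ?_
    rw [h0]
    exact Lp.coeFn_zero _ _ _
  have hE : EqOn z 0 (Ioi 0) :=
    Measure.eqOn_open_of_ae_eq hz0 isOpen_Ioi hz.continuousOn continuousOn_const
  rw [Lp.eq_zero_iff_ae_eq_zero]
  filter_upwards [h2, ae_restrict_mem measurableSet_Ioi] with x hx hx0
  have hd : deriv z x = 0 := by
    have he : z =ᶠ[𝓝 x] fun _ => (0 : Plane) := by
      filter_upwards [Ioi_mem_nhds hx0] with y hy using hE hy
    rw [he.deriv_eq, deriv_const]
  have hzx : z x = 0 := hE hx0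
  simp only [hx, tau, hd, hzx, map_zero, add_zero, Pi.zero_apply]

theorem A0_graph (P : ℝ → Matrix (Fin 2) (Fin 2) ℝ) : (A0 P).graph = graphA0 P :=
  Submodule.toLinearPMap_graph_eq _ (graphA0_single P)

/-- `lam` is an eigenvalue of the (possibly unbounded) operator `A`. -/
def IsEigenvalue (A : L2 →ₗ.[ℝ] L2) (lam : ℝ) : Prop :=
  ∃ f : A.domain, (f : L2) ≠ 0 ∧ A f = lam • (f : L2)

/-! ### The Prüfer angle -/

/-- `z` is a nontrivial solution that tends to `0` at `0`. -/
structure IsSmallSolution (P : ℝ → Matrix (Fin 2) (Fin 2) ℝ) (lam : ℝ) (z : ℝ → Plane) :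
    Prop where
  solution : IsSolution P lam z
  nontrivial : ∃ x, 0 < x ∧ z x ≠ 0
  small : Tendsto z (𝓝[>] 0) (𝓝 0)

/-- `θ` is an angular coordinate of `z` on `(0, ∞)`: `z = ρ (cos θ, sin θ)` with `ρ = ‖z‖`. -/
structure IsAngle (z : ℝ → Plane) (θ : ℝ → ℝ) : Prop where
  continuousOn : ContinuousOn θ (Ioi 0)
  fst_eq : ∀ x, 0 < x → z x 0 = ‖z x‖ * Real.cos (θ x)
  snd_eq : ∀ x, 0 < x → z x 1 = ‖z x‖ * Real.sin (θ x)

/-- `θ` is an angular coordinate, normalized by `θ(0⁺) ∈ [0, π)`, of a nontrivial solution that is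
small at `0`. -/
def IsNormalizedAngle (P : ℝ → Matrix (Fin 2) (Fin 2) ℝ) (lam : ℝ) (θ : ℝ → ℝ) : Prop :=
  ∃ z : ℝ → Plane, IsSmallSolution P lam z ∧ IsAngle z θ ∧
    ∃ θ0 ∈ Ico 0 Real.pi, Tendsto θ (𝓝[>] 0) (𝓝 θ0)

/-- `ν` is the value `ν(lam)`: normalized angles exist and all of them tend to `ν` at infinity.
At most one `ν` has this property. -/
def IsNu (P : ℝ → Matrix (Fin 2) (Fin 2) ℝ) (lam ν : ℝ) : Prop :=
  (∃ θ : ℝ → ℝ, IsNormalizedAngle P lam θ) ∧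
    ∀ θ : ℝ → ℝ, IsNormalizedAngle P lam θ → Tendsto θ atTop (𝓝 ν)

end DiracSystem

namespace DiracSystem

/-! Put Q = P - λ and z = ρ (cos θ, sin θ). The equation τ z = λ z becomes θ' = -⟪Qe, e⟫ and (log
ρ)' = ⟪Qe, e'⟫, where e is the direction of z and e' is e turned by π/2. These two pairings are
`quad` and `cross`. They satisfy `quad`' = 2 `cross`, and `quad` at φ times `quad` at φ + π/2 equals
`cross`² + det. Hence, when the determinant is negative, every zero of `quad` is simple and `cross`
equals ±√(-det) there.

Suppose the coefficients tend to constants with negative determinant. A level c with `quad` c ≠ 0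
can eventually be crossed by the angle in one direction only. Such levels are dense and π-periodic,
so the angle converges, and its limit is a zero of `quad` (`exists_tendsto_angle`). The logarithmic
rate of ρ then has a nonzero limit, up to a weight w ≥ 1, so ‖z‖ decays or grows exponentially
according to the sign of `cross` at the limit angle (`angle_limit_dichotomy`).

At infinity this applies to diag(μ⁻ - λ, μ⁺ - λ). At zero it applies in the variable t = -log x,
with limit matrix -P* and weight x^(1-β). The condition det P* < -1/4 when β = 1, or the divergence
of the weight when β > 1, turns growth into ‖z‖² ≥ C/x, which is not integrable. So a solution that
is square integrable near zero tends to 0 there (`alternative_at_zero`).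

A small solution exists because a suitable multiple of a growing solution can be subtracted from an
independent one (`exists_tendsto_zero_sub_mul`). It is unique up to scalars because the Wronskian of
two small solutions is a constant with limit 0. Therefore λ is an eigenvalue exactly when the small
solution decays at infinity, that is, when ν(λ) is the decaying direction of the limit matrix, which
`cross_neg_iff_of_quad_eq_zero` computes. -/

/-! ### The quadratic form of a symmetric matrix on the unit circle -/

/-- The value of the quadratic form of `!![a, b; b, d]` at the unit vector of angle `φ`. -/
noncomputable def quad (a b d φ : ℝ) : ℝ :=
  a * Real.cos φ ^ 2 + 2 * b * Real.sin φ * Real.cos φ + d * Real.sin φ ^ 2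

/-- The pairing `⟪Q e, e'⟫` for `Q = !![a, b; b, d]`, `e` the unit vector of angle `φ` and `e'` the
unit vector of angle `φ + π / 2`. -/
noncomputable def cross (a b d φ : ℝ) : ℝ :=
  b * (Real.cos φ ^ 2 - Real.sin φ ^ 2) + (d - a) * (Real.sin φ * Real.cos φ)

theorem quad_add_int_mul_pi (a b d φ : ℝ) (k : ℤ) :
    quad a b d (φ + k * Real.pi) = quad a b d φ := by
  have h : ((-1 : ℝ) ^ k) ^ 2 = 1 := by
    rw [← zpow_natCast, ← zpow_mul, mul_comm, zpow_mul]; norm_num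
  simp only [quad, Real.sin_add_int_mul_pi, Real.cos_add_int_mul_pi]
  linear_combination (a * Real.cos φ ^ 2 + 2 * b * Real.sin φ * Real.cos φ
    + d * Real.sin φ ^ 2) * h

theorem hasDerivAt_quad (a b d φ : ℝ) : HasDerivAt (quad a b d) (2 * cross a b d φ) φ := by
  have h := ((((Real.hasDerivAt_cos φ).pow 2).const_mul a).add
    (((Real.hasDerivAt_sin φ).const_mul (2 * b)).mul (Real.hasDerivAt_cos φ))).add
    (((Real.hasDerivAt_sin φ).pow 2).const_mul d)
  refine h.congr_deriv ?_
  simp only [cross]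
  push_cast
  ring

/-- In the orthonormal frame of angle φ the matrix has diagonal entries `quad` at φ and at φ + π/2
and off-diagonal entry `cross`; the determinant does not depend on the frame. -/
theorem quad_mul_quad_add_pi_div_two (a b d φ : ℝ) :
    quad a b d φ * quad a b d (φ + Real.pi / 2) = cross a b d φ ^ 2 + (a * d - b ^ 2) := by
  simp only [quad, cross, Real.sin_add_pi_div_two, Real.cos_add_pi_div_two]
  linear_combination (a * d - b ^ 2) * (Real.sin φ ^ 2 + Real.cos φ ^ 2 + 1)
    * Real.sin_sq_add_cos_sq φ

theorem cross_sq_of_quad_eq_zero {a b d φ : ℝ} (h : quad a b d φ = 0) :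
    cross a b d φ ^ 2 = -(a * d - b ^ 2) := by
  have := quad_mul_quad_add_pi_div_two a b d φ
  rw [h, zero_mul] at this
  linarith

theorem continuous_cross (a b d : ℝ) : Continuous (cross a b d) := by
  unfold cross; fun_prop

/-- A quarter turn changes the sign of `cross`, so it vanishes in between: this is a principal axis.
-/
theorem exists_cross_eq_zero (a b d : ℝ) : ∃ φ, cross a b d φ = 0 := by
  have h := isPreconnected_univ.intermediate_value₂ (mem_univ (0 : ℝ)) (mem_univ (Real.pi / 2))
    (continuous_cross a b d).continuousOn (g := fun _ => 0) continuousOn_const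
  have h' := isPreconnected_univ.intermediate_value₂ (mem_univ (Real.pi / 2)) (mem_univ (0 : ℝ))
    (continuous_cross a b d).continuousOn (g := fun _ => 0) continuousOn_const
  have h0 : cross a b d 0 = b := by simp [cross]
  have h1 : cross a b d (Real.pi / 2) = -b := by simp [cross]
  rw [h0, h1] at h h'
  rcases le_total b 0 with hb | hb
  · obtain ⟨φ, -, hφ⟩ := h hb (by linarith)
    exact ⟨φ, hφ⟩
  · obtain ⟨φ, -, hφ⟩ := h' (by linarith) hb
    exact ⟨φ, hφ⟩

theorem exists_quad_pos_and_neg {a b d : ℝ} (hdet : a * d - b ^ 2 < 0) :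
    (∃ φ, 0 < quad a b d φ) ∧ ∃ φ, quad a b d φ < 0 := by
  obtain ⟨φ, hφ⟩ := exists_cross_eq_zero a b d
  have h := quad_mul_quad_add_pi_div_two a b d φ
  rw [hφ] at h
  have h' : quad a b d φ * quad a b d (φ + Real.pi / 2) < 0 := by linarith
  rcases mul_neg_iff.1 h' with ⟨h1, h2⟩ | ⟨h1, h2⟩
  exacts [⟨⟨_, h1⟩, ⟨_, h2⟩⟩, ⟨⟨_, h2⟩, ⟨_, h1⟩⟩]

/-- At a zero the derivative 2 `cross` is nonzero, so zeros are isolated. -/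
theorem dense_quad_ne_zero {a b d : ℝ} (hdet : a * d - b ^ 2 < 0) :
    Dense {φ | quad a b d φ ≠ 0} := by
  intro φ
  by_cases h : quad a b d φ = 0
  · have hc : cross a b d φ ≠ 0 := fun h0 => by
      have := cross_sq_of_quad_eq_zero h
      rw [h0] at this
      linarith
    have hne := (hasDerivAt_quad a b d φ).eventually_ne (c := 0) (by simpa using hc)
    exact mem_closure_iff_frequently.2 (hne.frequently.filter_mono nhdsWithin_le_nhds)
  · exact subset_closure h

theorem tendsto_quad {ι : Type*} {l : Filter ι} {a b d φ : ι → ℝ} {A B D L : ℝ}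
    (ha : Tendsto a l (𝓝 A)) (hb : Tendsto b l (𝓝 B)) (hd : Tendsto d l (𝓝 D))
    (hφ : Tendsto φ l (𝓝 L)) :
    Tendsto (fun i => quad (a i) (b i) (d i) (φ i)) l (𝓝 (quad A B D L)) := by
  have hc := (Real.continuous_cos.tendsto L).comp hφ
  have hs := (Real.continuous_sin.tendsto L).comp hφ
  exact ((ha.mul (hc.pow 2)).add (((hb.const_mul 2).mul hs).mul hc)).add (hd.mul (hs.pow 2))

theorem tendsto_cross {ι : Type*} {l : Filter ι} {a b d φ : ι → ℝ} {A B D L : ℝ}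
    (ha : Tendsto a l (𝓝 A)) (hb : Tendsto b l (𝓝 B)) (hd : Tendsto d l (𝓝 D))
    (hφ : Tendsto φ l (𝓝 L)) :
    Tendsto (fun i => cross (a i) (b i) (d i) (φ i)) l (𝓝 (cross A B D L)) := by
  have hc := (Real.continuous_cos.tendsto L).comp hφ
  have hs := (Real.continuous_sin.tendsto L).comp hφ
  exact (hb.mul ((hc.pow 2).sub (hs.pow 2))).add ((hd.sub ha).mul (hs.mul hc))

/-! ### Asymptotics of the angle -/

/-- A differentiable function that decreases whenever it takes the value `c` cannot cross the level
`c` upwards. -/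
theorem le_of_forall_deriv_neg_of_eq {f f' : ℝ → ℝ} {c T t s : ℝ}
    (hf : ∀ x, T ≤ x → HasDerivAt f (f' x) x) (hneg : ∀ x, T ≤ x → f x = c → f' x < 0)
    (hT : T ≤ t) (hts : t ≤ s) (ht : f t ≤ c) : f s ≤ c := by
  refine image_le_of_deriv_right_lt_deriv_boundary (f' := f') (B := fun _ => c) (B' := fun _ => 0)
    (fun x hx => (hf x (hT.trans hx.1)).continuousAt.continuousWithinAt)
    (fun x hx => (hf x (hT.trans hx.1)).hasDerivWithinAt) ht (fun x => hasDerivAt_const x c)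
    (fun x hx h => hneg x (hT.trans hx.1) h) ⟨hts, le_rfl⟩

theorem ge_of_forall_deriv_pos_of_eq {f f' : ℝ → ℝ} {c T t s : ℝ}
    (hf : ∀ x, T ≤ x → HasDerivAt f (f' x) x) (hpos : ∀ x, T ≤ x → f x = c → 0 < f' x)
    (hT : T ≤ t) (hts : t ≤ s) (ht : c ≤ f t) : c ≤ f s := by
  have := le_of_forall_deriv_neg_of_eq (f := fun x => -f x) (f' := fun x => -f' x) (c := -c)
    (fun x hx => (hf x hx).neg) (fun x hx h => by have := hpos x hx (by linarith); linarith)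
    hT hts (by linarith)
  linarith

/-- By the mean value theorem the increments over unit intervals stay below -ε, whereas convergence
would make them tend to 0. -/
theorem not_tendsto_of_deriv_le {f f' : ℝ → ℝ} {L ε : ℝ} (hε : 0 < ε)
    (hf : ∀ᶠ x in atTop, HasDerivAt f (f' x) x ∧ f' x ≤ -ε) : ¬ Tendsto f atTop (𝓝 L) := by
  intro hL
  obtain ⟨T, hT⟩ := eventually_atTop.1 hf
  have h1 : Tendsto (fun x => f (x + 1) - f x) atTop (𝓝 (L - L)) :=
    (hL.comp (tendsto_atTop_add_const_right _ 1 tendsto_id)).sub hL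
  rw [sub_self] at h1
  have h2 : ∀ᶠ x in atTop, f (x + 1) - f x ≤ -ε := by
    filter_upwards [eventually_ge_atTop T] with x hx
    obtain ⟨c, hc, hc'⟩ := exists_hasDerivAt_eq_slope f f' (show x < x + 1 by linarith)
      (fun y hy => (hT y (hx.trans hy.1)).1.continuousAt.continuousWithinAt)
      (fun y hy => (hT y (hx.trans hy.1.le)).1)
    have := (hT c (hx.trans hc.1.le)).2
    rw [hc'] at this
    simpa using this
  have := le_of_tendsto h1 h2
  linarith

/-- Solutions of the angle equation of an asymptotically constant trace-free hyperbolic system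
converge to one of its invariant directions. -/
theorem exists_tendsto_angle {a b d w φ : ℝ → ℝ} {A B D : ℝ}
    (ha : Tendsto a atTop (𝓝 A)) (hb : Tendsto b atTop (𝓝 B)) (hd : Tendsto d atTop (𝓝 D))
    (hw : ∀ᶠ t in atTop, 1 ≤ w t) (hdet : A * D - B ^ 2 < 0)
    (hφ : ∀ᶠ t in atTop, HasDerivAt φ (-(w t * quad (a t) (b t) (d t) (φ t))) t) :
    ∃ L, Tendsto φ atTop (𝓝 L) ∧ quad A B D L = 0 := by
  -- A level with positive limit form is a barrier against upward crossing. By π-periodicity one T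
  -- serves all its translates, which later gives boundedness of φ.
  have hup : ∀ c, 0 < quad A B D c → ∃ T, ∀ k : ℤ, ∀ t, T ≤ t → φ t ≤ c + k * Real.pi →
      ∀ s, t ≤ s → φ s ≤ c + k * Real.pi := by
    intro c hc
    have h1 := (tendsto_quad ha hb hd (tendsto_const_nhds (x := c))).eventually_const_lt hc
    obtain ⟨T, hT⟩ := eventually_atTop.1 (h1.and (hw.and hφ))
    refine ⟨T, fun k t ht h s hs => le_of_forall_deriv_neg_of_eq (fun x hx => (hT x hx).2.2)
      (fun x hx hxc => ?_) ht hs h⟩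
    rw [hxc, quad_add_int_mul_pi, neg_lt_zero]
    exact mul_pos (by linarith [(hT x hx).2.1]) (hT x hx).1
  have hdown : ∀ c, quad A B D c < 0 → ∃ T, ∀ k : ℤ, ∀ t, T ≤ t → c + k * Real.pi ≤ φ t →
      ∀ s, t ≤ s → c + k * Real.pi ≤ φ s := by
    intro c hc
    have h1 := (tendsto_quad ha hb hd (tendsto_const_nhds (x := c))).eventually_lt_const hc
    obtain ⟨T, hT⟩ := eventually_atTop.1 (h1.and (hw.and hφ))
    refine ⟨T, fun k t ht h s hs => ge_of_forall_deriv_pos_of_eq (fun x hx => (hT x hx).2.2)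
      (fun x hx hxc => ?_) ht hs h⟩
    rw [hxc, quad_add_int_mul_pi, neg_pos]
    exact mul_neg_of_pos_of_neg (by linarith [(hT x hx).2.1]) (hT x hx).1
  obtain ⟨⟨cp, hcp⟩, ⟨cm, hcm⟩⟩ := exists_quad_pos_and_neg hdet
  have hconv : ∃ L, Tendsto φ atTop (𝓝 L) := by
    -- Between c < c' the barrier at c alone suffices: depending on the sign of the form at c, φ can
    -- no longer return below c, or no longer leave upwards.
    refine tendsto_of_no_upcrossings (dense_quad_ne_zero hdet) ?_ ?_ ?_
    · rintro c hc c' - hcc' ⟨h1, h2⟩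
      rcases lt_or_gt_of_ne hc with hc | hc
      · obtain ⟨T, hT⟩ := hdown c hc
        obtain ⟨t, ht, htT⟩ := (h2.and_eventually (eventually_ge_atTop T)).exists
        obtain ⟨s, hs, hts⟩ := (h1.and_eventually (eventually_ge_atTop t)).exists
        have := hT 0 t htT (by simpa using (hcc'.trans ht).le) s hts
        simp only [Int.cast_zero, zero_mul, add_zero] at this
        linarith
      · obtain ⟨T, hT⟩ := hup c hc
        obtain ⟨t, ht, htT⟩ := (h1.and_eventually (eventually_ge_atTop T)).exists
        obtain ⟨s, hs, hts⟩ := (h2.and_eventually (eventually_ge_atTop t)).exists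
        have := hT 0 t htT (by simpa using ht.le) s hts
        simp only [Int.cast_zero, zero_mul, add_zero] at this
        linarith
    · obtain ⟨T, hT⟩ := hup cp hcp
      obtain ⟨k, hk⟩ := exists_int_gt ((φ T - cp) / Real.pi)
      rw [div_lt_iff₀ Real.pi_pos] at hk
      exact isBoundedUnder_of_eventually_le ((eventually_ge_atTop T).mono
        (hT k T le_rfl (by linarith)))
    · obtain ⟨T, hT⟩ := hdown cm hcm
      obtain ⟨k, hk⟩ := exists_int_lt ((φ T - cm) / Real.pi)
      rw [lt_div_iff₀ Real.pi_pos] at hk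
      exact isBoundedUnder_of_eventually_ge ((eventually_ge_atTop T).mono
        (hT k T le_rfl (by linarith)))
  obtain ⟨L, hL⟩ := hconv
  refine ⟨L, hL, ?_⟩
  have hq := tendsto_quad ha hb hd hL
  -- If the form were nonzero at L, the speed of φ would stay away from 0 with a fixed sign.
  by_contra hne
  rcases lt_or_gt_of_ne hne with h | h
  · refine not_tendsto_of_deriv_le (f := fun x => -φ x)
      (f' := fun t => w t * quad (a t) (b t) (d t) (φ t))
      (ε := -quad A B D L / 2) (by linarith) ?_ hL.neg
    filter_upwards [hq.eventually_lt_const (show quad A B D L < quad A B D L / 2 by linarith),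
      hw, hφ] with t h1 h2 h3
    refine ⟨h3.neg.congr_deriv (neg_neg _), ?_⟩
    nlinarith
  · refine not_tendsto_of_deriv_le (f' := fun t => -(w t * quad (a t) (b t) (d t) (φ t)))
      (ε := quad A B D L / 2) (by linarith) ?_ hL
    filter_upwards [hq.eventually_const_lt (show quad A B D L / 2 < quad A B D L by linarith),
      hw, hφ] with t h1 h2 h3
    refine ⟨h3, ?_⟩
    nlinarith

/-! ### Planar trace-free linear systems -/

/-- The pair `(u, v)` satisfies `u' = q u + r v`, `v' = -p u - q v` at `t`. -/
def SolvesAt (p q r u v : ℝ → ℝ) (t : ℝ) : Prop :=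
  HasDerivAt u (q t * u t + r t * v t) t ∧ HasDerivAt v (-(p t * u t) - q t * v t) t

section SolvesAt

variable {p q r u v u₁ v₁ u₂ v₂ : ℝ → ℝ} {t : ℝ}

theorem SolvesAt.hasDerivAt_normSq (h : SolvesAt p q r u v t) :
    HasDerivAt (fun t => u t ^ 2 + v t ^ 2)
      (2 * (q t * (u t ^ 2 - v t ^ 2) + (r t - p t) * (u t * v t))) t := by
  refine ((h.1.pow 2).add (h.2.pow 2)).congr_deriv ?_
  push_cast
  ring

theorem SolvesAt.hasDerivAt_wronskian (h₁ : SolvesAt p q r u₁ v₁ t)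
    (h₂ : SolvesAt p q r u₂ v₂ t) :
    HasDerivAt (fun t => u₁ t * v₂ t - u₂ t * v₁ t) 0 t := by
  refine ((h₁.1.mul h₂.2).sub (h₂.1.mul h₁.2)).congr_deriv ?_
  ring

/-- The quotient is the coordinate of the second solution along the first. Its derivative carries
the Wronskian as a factor, so it is constant for dependent solutions and varies slowly when the
first one grows. -/
theorem SolvesAt.hasDerivAt_ratio (h₁ : SolvesAt p q r u₁ v₁ t) (h₂ : SolvesAt p q r u₂ v₂ t)
    (hR : u₁ t ^ 2 + v₁ t ^ 2 ≠ 0) :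
    HasDerivAt (fun t => (u₁ t * u₂ t + v₁ t * v₂ t) / (u₁ t ^ 2 + v₁ t ^ 2))
      ((u₁ t * v₂ t - u₂ t * v₁ t) * ((r t - p t) * (u₁ t ^ 2 - v₁ t ^ 2)
        - 4 * q t * (u₁ t * v₁ t)) / (u₁ t ^ 2 + v₁ t ^ 2) ^ 2) t := by
  refine (((h₁.1.mul h₂.1).add (h₁.2.mul h₂.2)).div h₁.hasDerivAt_normSq hR).congr_deriv ?_
  congr 1
  simp only [Pi.add_apply, Pi.mul_apply]
  ring

theorem SolvesAt.add_const_mul (h₁ : SolvesAt p q r u₁ v₁ t) (h₂ : SolvesAt p q r u₂ v₂ t)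
    (c : ℝ) : SolvesAt p q r (fun t => u₂ t + c * u₁ t) (fun t => v₂ t + c * v₁ t) t :=
  ⟨(h₂.1.add (h₁.1.const_mul c)).congr_deriv (by ring),
    (h₂.2.add (h₁.2.const_mul c)).congr_deriv (by ring)⟩

theorem SolvesAt.comp_exp_neg {x : ℝ} (h : SolvesAt p q r u v x) (hx : x = Real.exp (-t)) :
    SolvesAt (fun t => -(Real.exp (-t) * p (Real.exp (-t))))
      (fun t => -(Real.exp (-t) * q (Real.exp (-t))))
      (fun t => -(Real.exp (-t) * r (Real.exp (-t))))
      (fun t => u (Real.exp (-t))) (fun t => v (Real.exp (-t))) t := by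
  subst hx
  have he : HasDerivAt (fun t : ℝ => Real.exp (-t)) (Real.exp (-t) * (-1)) t :=
    (hasDerivAt_neg t).exp
  exact ⟨(h.1.comp t he).congr_deriv (by ring), (h.2.comp t he).congr_deriv (by ring)⟩

end SolvesAt

/-! ### Exponential growth and decay -/

/-- The function R(t) exp(-κt) is eventually nondecreasing; κ may have either sign. -/
theorem exists_mul_exp_le {R R' : ℝ → ℝ} {κ : ℝ} (hpos : ∀ᶠ t in atTop, 0 < R t)
    (hR : ∀ᶠ t in atTop, HasDerivAt R (R' t) t) (hle : ∀ᶠ t in atTop, κ * R t ≤ R' t) :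
    ∃ C > 0, ∀ᶠ t in atTop, C * Real.exp (κ * t) ≤ R t := by
  obtain ⟨T, hT⟩ := eventually_atTop.1 (hpos.and (hR.and hle))
  have hd : ∀ t, T ≤ t → HasDerivAt (fun t => R t * Real.exp (-(κ * t)))
      ((R' t - κ * R t) * Real.exp (-(κ * t))) t := fun t ht => by
    refine ((hT t ht).2.1.mul ((hasDerivAt_id t).const_mul κ).neg.exp).congr_deriv ?_
    simp only [id, mul_one, Pi.neg_apply]
    ring
  have hm : MonotoneOn (fun t => R t * Real.exp (-(κ * t))) (Ici T) := by
    refine monotoneOn_of_deriv_nonneg (convex_Ici T)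
      (fun t ht => (hd t ht).continuousAt.continuousWithinAt)
      (fun t ht => (hd t (interior_subset ht)).differentiableAt.differentiableWithinAt)
      (fun t ht => ?_)
    have ht' := interior_subset ht
    rw [(hd t ht').deriv]
    exact mul_nonneg (by linarith [(hT t ht').2.2]) (Real.exp_pos _).le
  refine ⟨R T * Real.exp (-(κ * T)), mul_pos (hT T le_rfl).1 (Real.exp_pos _), ?_⟩
  filter_upwards [eventually_ge_atTop T] with t ht
  calc R T * Real.exp (-(κ * T)) * Real.exp (κ * t)
      ≤ R t * Real.exp (-(κ * t)) * Real.exp (κ * t) :=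
        mul_le_mul_of_nonneg_right (hm self_mem_Ici ht ht) (Real.exp_pos _).le
    _ = R t := by rw [mul_assoc, ← Real.exp_add]; simp

theorem exists_le_mul_exp {R R' : ℝ → ℝ} {κ : ℝ} (hpos : ∀ᶠ t in atTop, 0 < R t)
    (hR : ∀ᶠ t in atTop, HasDerivAt R (R' t) t) (hle : ∀ᶠ t in atTop, R' t ≤ κ * R t) :
    ∃ C > 0, ∀ᶠ t in atTop, R t ≤ C * Real.exp (κ * t) := by
  obtain ⟨C, hC, h⟩ := exists_mul_exp_le (R := fun t => (R t)⁻¹)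
    (R' := fun t => -R' t / R t ^ 2) (κ := -κ) (hpos.mono fun t ht => inv_pos.2 ht)
    (by filter_upwards [hpos, hR] with t h1 h2 using h2.inv h1.ne')
    (by
      filter_upwards [hpos, hle] with t h1 h2
      rw [le_div_iff₀ (by positivity)]
      field_simp
      linarith)
  refine ⟨C⁻¹, inv_pos.2 hC, ?_⟩
  filter_upwards [h, hpos] with t h1 h2
  have h3 := inv_anti₀ (by positivity) h1
  rw [inv_inv, mul_inv, ← Real.exp_neg] at h3
  simpa using h3

/-- Subtracting a multiple of a growing solution from an arbitrary solution yields a solution that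
tends to `0`. -/
theorem exists_tendsto_zero_sub_mul {a b d w u₁ v₁ u₂ v₂ : ℝ → ℝ} {K κ W : ℝ} (hκ : 0 < κ)
    (hw : ∀ᶠ t in atTop, 1 ≤ w t)
    (hK : ∀ᶠ t in atTop, |a t| + 2 * |b t| + |d t| ≤ K)
    (h₁ : ∀ᶠ t in atTop, SolvesAt (fun t => w t * a t) (fun t => w t * b t)
      (fun t => w t * d t) u₁ v₁ t)
    (h₂ : ∀ᶠ t in atTop, SolvesAt (fun t => w t * a t) (fun t => w t * b t)
      (fun t => w t * d t) u₂ v₂ t)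
    (hW : ∀ᶠ t in atTop, u₁ t * v₂ t - u₂ t * v₁ t = W)
    (hpos : ∀ᶠ t in atTop, 0 < u₁ t ^ 2 + v₁ t ^ 2)
    (hgrow : ∀ᶠ t in atTop, κ * (u₁ t ^ 2 + v₁ t ^ 2) ≤
      2 * (b t * (u₁ t ^ 2 - v₁ t ^ 2) + (d t - a t) * (u₁ t * v₁ t))) :
    ∃ ℓ : ℝ, Tendsto (fun t => u₂ t + ℓ * u₁ t) atTop (𝓝 0) ∧
      Tendsto (fun t => v₂ t + ℓ * v₁ t) atTop (𝓝 0) := by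
  set R : ℝ → ℝ := fun t => u₁ t ^ 2 + v₁ t ^ 2 with hR
  -- Orthogonal decomposition: z₂ = c z₁ + (W / R) (-v₁, u₁).
  set c : ℝ → ℝ := fun t => (u₁ t * u₂ t + v₁ t * v₂ t) / (u₁ t ^ 2 + v₁ t ^ 2) with hc
  have hRinf : Tendsto R atTop atTop := by
    obtain ⟨C, hC, h⟩ := exists_mul_exp_le (κ := κ) hpos (h₁.mono fun t h => h.hasDerivAt_normSq)
      (by
        filter_upwards [hw, hgrow, hpos] with t h1 h2 h3
        have : 0 < κ * R t := by positivity
        nlinarith)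
    refine tendsto_atTop_mono' _ h (Tendsto.const_mul_atTop hC ?_)
    exact Real.tendsto_exp_atTop.comp (tendsto_id.const_mul_atTop hκ)
  -- With this constant |c'| ≤ -(C / R)', so c - C / R increases and c + C / R decreases. This traps
  -- a number ℓ with |c - ℓ| ≤ C / R without integrating c'.
  set C : ℝ := |W| * K / κ with hCdef
  obtain ⟨T, hT⟩ := eventually_atTop.1
    (hw.and (hK.and (h₁.and (h₂.and (hW.and (hpos.and hgrow))))))
  have hRd : ∀ t, T ≤ t → HasDerivAt (fun t => C / R t)
      (-(C * (w t * (2 * (b t * (u₁ t ^ 2 - v₁ t ^ 2) + (d t - a t) * (u₁ t * v₁ t)))))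
        / R t ^ 2) t := by
    intro t ht
    obtain ⟨_, _, h1, _, _, h4, _⟩ := hT t ht
    refine ((hasDerivAt_const t C).div h1.hasDerivAt_normSq h4.ne').congr_deriv ?_
    congr 1
    ring
  have hcd : ∀ t, T ≤ t → HasDerivAt c
      (W * (w t * ((d t - a t) * (u₁ t ^ 2 - v₁ t ^ 2) - 4 * b t * (u₁ t * v₁ t)))
        / R t ^ 2) t := by
    intro t ht
    obtain ⟨_, _, h1, h2, h3, h4, _⟩ := hT t ht
    refine (h1.hasDerivAt_ratio h2 h4.ne').congr_deriv ?_
    rw [h3]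
    congr 1
    ring
  have hbound : ∀ t, T ≤ t →
      |W * (w t * ((d t - a t) * (u₁ t ^ 2 - v₁ t ^ 2) - 4 * b t * (u₁ t * v₁ t)))| ≤
      C * (w t * (2 * (b t * (u₁ t ^ 2 - v₁ t ^ 2) + (d t - a t) * (u₁ t * v₁ t)))) := by
    intro t ht
    obtain ⟨h0, h1, _, _, _, h4, h5⟩ := hT t ht
    have hw0 : 0 ≤ w t := by linarith
    have e1 : |(d t - a t) * (u₁ t ^ 2 - v₁ t ^ 2) - 4 * b t * (u₁ t * v₁ t)| ≤ K * R t := by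
      have f1 : |u₁ t ^ 2 - v₁ t ^ 2| ≤ R t := by
        rw [abs_le]; constructor <;> nlinarith [sq_nonneg (u₁ t), sq_nonneg (v₁ t)]
      have f2 : |2 * (u₁ t * v₁ t)| ≤ R t := by
        rw [abs_le]; constructor <;> nlinarith [sq_nonneg (u₁ t + v₁ t), sq_nonneg (u₁ t - v₁ t)]
      calc _ = |(d t - a t) * (u₁ t ^ 2 - v₁ t ^ 2) - 2 * b t * (2 * (u₁ t * v₁ t))| := by ring_nf
        _ ≤ |(d t - a t) * (u₁ t ^ 2 - v₁ t ^ 2)| + |2 * b t * (2 * (u₁ t * v₁ t))| := abs_sub _ _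
        _ = |d t - a t| * |u₁ t ^ 2 - v₁ t ^ 2| + 2 * |b t| * |2 * (u₁ t * v₁ t)| := by
          rw [abs_mul, abs_mul (2 * b t), abs_mul 2 (b t), abs_two]
        _ ≤ (|d t| + |a t|) * R t + 2 * |b t| * R t := by
          gcongr
          exact abs_sub _ _
        _ = (|a t| + 2 * |b t| + |d t|) * R t := by ring
        _ ≤ K * R t := by gcongr
    have hK0 : 0 ≤ K := le_trans (by positivity) h1
    rw [abs_mul, abs_mul (w t), abs_of_nonneg hw0]
    calc |W| * (w t * |(d t - a t) * (u₁ t ^ 2 - v₁ t ^ 2) - 4 * b t * (u₁ t * v₁ t)|)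
        ≤ |W| * (w t * (K * R t)) := by gcongr
      _ = C * (w t * (κ * R t)) := by rw [hCdef]; field_simp
      _ ≤ _ := by gcongr
  have hmono : MonotoneOn (fun t => c t - C / R t) (Ici T) := by
    have hd := fun t (ht : T ≤ t) => (hcd t ht).sub (hRd t ht)
    refine monotoneOn_of_deriv_nonneg (convex_Ici T)
      (fun t ht => (hd t ht).continuousAt.continuousWithinAt)
      (fun t ht => (hd t (interior_subset ht)).differentiableAt.differentiableWithinAt)
      (fun t ht => ?_)
    have ht' := interior_subset ht
    have := (abs_le.1 (hbound t ht')).1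
    refine (hd t ht').deriv.symm ▸ ?_
    rw [← sub_div]
    exact div_nonneg (by linarith) (sq_nonneg _)
  have hanti : AntitoneOn (fun t => c t + C / R t) (Ici T) := by
    have hd := fun t (ht : T ≤ t) => (hcd t ht).add (hRd t ht)
    refine antitoneOn_of_deriv_nonpos (convex_Ici T)
      (fun t ht => (hd t ht).continuousAt.continuousWithinAt)
      (fun t ht => (hd t (interior_subset ht)).differentiableAt.differentiableWithinAt)
      (fun t ht => ?_)
    have ht' := interior_subset ht
    have := (abs_le.1 (hbound t ht')).2
    refine (hd t ht').deriv.symm ▸ ?_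
    rw [← add_div]
    exact div_nonpos_of_nonpos_of_nonneg (by linarith) (sq_nonneg _)
  have hC0 : 0 ≤ C := by
    have hK0 : 0 ≤ K := le_trans (by positivity) (hT T le_rfl).2.1
    positivity
  have hRpos : ∀ t, T ≤ t → 0 < R t := fun t ht => (hT t ht).2.2.2.2.2.1
  have hle : ∀ s t, T ≤ s → T ≤ t → c s - C / R s ≤ c t + C / R t := by
    intro s t hs ht
    have h1 := hmono (mem_Ici.2 hs) (mem_Ici.2 (hs.trans (le_max_left s t))) (le_max_left s t)
    have h2 := hanti (mem_Ici.2 ht) (mem_Ici.2 (ht.trans (le_max_right s t))) (le_max_right s t)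
    have h3 : 0 ≤ C / R (max s t) := div_nonneg hC0 (hRpos _ (hs.trans (le_max_left s t))).le
    simp only at h1 h2
    linarith
  obtain ⟨ℓ, hℓ1, hℓ2⟩ : ∃ ℓ, (∀ t, T ≤ t → c t - C / R t ≤ ℓ) ∧ ∀ t, T ≤ t → ℓ ≤ c t + C / R t := by
    refine ⟨sSup ((fun t => c t - C / R t) '' Ici T), fun t ht => le_csSup ?_ ⟨t, ht, rfl⟩,
      fun t ht => csSup_le ⟨_, T, self_mem_Ici, rfl⟩ ?_⟩
    · refine ⟨c T + C / R T, ?_⟩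
      rintro _ ⟨s, hs, rfl⟩
      exact hle s T hs le_rfl
    · rintro _ ⟨s, hs, rfl⟩
      exact hle s t hs ht
  -- z₂ - ℓ z₁ = (c - ℓ) z₁ + (W / R) (-v₁, u₁), and each coordinate of z₁ is at most √R in absolute
  -- value.
  have hlim : Tendsto (fun t => (C + |W|) / Real.sqrt (R t)) atTop (𝓝 0) :=
    tendsto_const_nhds.div_atTop (Real.tendsto_sqrt_atTop.comp hRinf)
  have key : ∀ t, T ≤ t → ∀ x y : ℝ, |x| ≤ Real.sqrt (R t) → |y| ≤ Real.sqrt (R t) →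
      |(c t - ℓ) * x + W / R t * y| ≤ (C + |W|) / Real.sqrt (R t) := by
    intro t ht x y hx hy
    have h1 : |c t - ℓ| ≤ C / R t := by
      rw [abs_le]; constructor <;> linarith [hℓ1 t ht, hℓ2 t ht]
    have hs := Real.sqrt_pos.2 (hRpos t ht)
    calc |(c t - ℓ) * x + W / R t * y| ≤ |(c t - ℓ) * x| + |W / R t * y| := abs_add_le _ _
      _ = |c t - ℓ| * |x| + |W| / R t * |y| := by
        rw [abs_mul, abs_mul, abs_div, abs_of_pos (hRpos t ht)]
      _ ≤ C / R t * Real.sqrt (R t) + |W| / R t * Real.sqrt (R t) := by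
        have : 0 ≤ |W| / R t := div_nonneg (abs_nonneg _) (hRpos t ht).le
        gcongr
      _ = (C + |W|) / Real.sqrt (R t) := by
        rw [← add_mul, ← add_div, div_mul_eq_mul_div, div_eq_div_iff (hRpos t ht).ne' hs.ne',
          mul_assoc, Real.mul_self_sqrt (hRpos t ht).le]
  refine ⟨-ℓ, ?_, ?_⟩
  · refine squeeze_zero_norm' ?_ hlim
    filter_upwards [eventually_ge_atTop T] with t ht
    have := key t ht (u₁ t) (-v₁ t) (Real.abs_le_sqrt (by simp only [hR]; nlinarith [sq_nonneg (v₁ t)]))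
      (Real.abs_le_sqrt (by simp only [hR]; nlinarith [sq_nonneg (u₁ t)]))
    have h0 := (hRpos t ht).ne'
    simp only [hR] at h0
    have e : u₂ t + -ℓ * u₁ t = (c t - ℓ) * u₁ t + W / R t * -v₁ t := by
      simp only [hc, hR, ← (hT t ht).2.2.2.2.1]
      field_simp
      ring
    rw [e]
    exact this
  · refine squeeze_zero_norm' ?_ hlim
    filter_upwards [eventually_ge_atTop T] with t ht
    have := key t ht (v₁ t) (u₁ t) (Real.abs_le_sqrt (by simp only [hR]; nlinarith [sq_nonneg (u₁ t)]))
      (Real.abs_le_sqrt (by simp only [hR]; nlinarith [sq_nonneg (v₁ t)]))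
    have h0 := (hRpos t ht).ne'
    simp only [hR] at h0
    have e : v₂ t + -ℓ * v₁ t = (c t - ℓ) * v₁ t + W / R t * u₁ t := by
      simp only [hc, hR, ← (hT t ht).2.2.2.2.1]
      field_simp
      ring
    rw [e]
    exact this

/-- The alternative for a solution with angle `φ` of an asymptotically constant trace-free hyperbolic
system. -/
theorem angle_limit_dichotomy {a b d w u v ρ φ : ℝ → ℝ} {A B D : ℝ}
    (ha : Tendsto a atTop (𝓝 A)) (hb : Tendsto b atTop (𝓝 B)) (hd : Tendsto d atTop (𝓝 D))
    (hw : ∀ᶠ t in atTop, 1 ≤ w t) (hdet : A * D - B ^ 2 < 0)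
    (hs : ∀ᶠ t in atTop, SolvesAt (fun t => w t * a t) (fun t => w t * b t)
      (fun t => w t * d t) u v t)
    (hρ : ∀ᶠ t in atTop, 0 < ρ t)
    (hu : ∀ᶠ t in atTop, u t = ρ t * Real.cos (φ t))
    (hv : ∀ᶠ t in atTop, v t = ρ t * Real.sin (φ t))
    (hφ : ∀ᶠ t in atTop, HasDerivAt φ (-(w t * quad (a t) (b t) (d t) (φ t))) t) :
    ∃ L, Tendsto φ atTop (𝓝 L) ∧ quad A B D L = 0 ∧
      ((cross A B D L < 0 ∧
          ∃ κ > 0, ∃ C > 0, ∀ᶠ t in atTop, u t ^ 2 + v t ^ 2 ≤ C * Real.exp (-(κ * t))) ∨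
        (0 < cross A B D L ∧
          (∃ κ > 0, ∀ᶠ t in atTop, κ * (u t ^ 2 + v t ^ 2) ≤
            2 * (b t * (u t ^ 2 - v t ^ 2) + (d t - a t) * (u t * v t))) ∧
          (∃ κ > 0, ∃ C > 0, ∀ᶠ t in atTop, C * Real.exp (κ * t) ≤ u t ^ 2 + v t ^ 2) ∧
          ((A * D - B ^ 2 < -1 / 4 ∨ Tendsto w atTop atTop) →
            ∃ C > 0, ∀ᶠ t in atTop, C * Real.exp t ≤ u t ^ 2 + v t ^ 2))) := by
  obtain ⟨L, hL, hq⟩ := exists_tendsto_angle ha hb hd hw hdet hφ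
  refine ⟨L, hL, hq, ?_⟩
  have hc := tendsto_cross ha hb hd hL
  have hsq := cross_sq_of_quad_eq_zero hq
  have hRρ : ∀ᶠ t in atTop, u t ^ 2 + v t ^ 2 = ρ t ^ 2 := by
    filter_upwards [hu, hv] with t h1 h2
    rw [h1, h2]
    linear_combination ρ t ^ 2 * Real.sin_sq_add_cos_sq (φ t)
  have hpos : ∀ᶠ t in atTop, 0 < u t ^ 2 + v t ^ 2 := by
    filter_upwards [hRρ, hρ] with t h1 h2
    rw [h1]; positivity
  have hX : ∀ᶠ t in atTop, b t * (u t ^ 2 - v t ^ 2) + (d t - a t) * (u t * v t) =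
      cross (a t) (b t) (d t) (φ t) * (u t ^ 2 + v t ^ 2) := by
    filter_upwards [hRρ, hu, hv] with t h1 h2 h3
    rw [h1, h2, h3, cross]
    ring
  have hder : ∀ᶠ t in atTop, HasDerivAt (fun t => u t ^ 2 + v t ^ 2)
      (2 * w t * cross (a t) (b t) (d t) (φ t) * (u t ^ 2 + v t ^ 2)) t := by
    filter_upwards [hs, hX] with t h1 h2
    refine h1.hasDerivAt_normSq.congr_deriv ?_
    linear_combination 2 * w t * h2
  have hne : cross A B D L ≠ 0 := fun h0 => by
    rw [h0] at hsq
    linarith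
  rcases lt_or_gt_of_ne hne with h | h
  · refine Or.inl ⟨h, -cross A B D L, by linarith, ?_⟩
    have := exists_le_mul_exp (κ := cross A B D L) hpos hder (by
      filter_upwards [hpos, hw,
        hc.eventually_lt_const (show cross A B D L < cross A B D L / 2 by linarith)] with t h1 h2 h3
      refine mul_le_mul_of_nonneg_right ?_ h1.le
      nlinarith)
    simpa using this
  · refine Or.inr ⟨h, ⟨cross A B D L, h, ?_⟩, ⟨cross A B D L, h, ?_⟩, fun hstrong => ?_⟩
    · filter_upwards [hX, hpos,
        hc.eventually_const_lt (show cross A B D L / 2 < cross A B D L by linarith)] with t h1 h2 h3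
      rw [h1, ← mul_assoc]
      exact mul_le_mul_of_nonneg_right (by linarith) h2.le
    · exact exists_mul_exp_le hpos hder (by
        filter_upwards [hpos, hw,
          hc.eventually_const_lt (show cross A B D L / 2 < cross A B D L by linarith)]
          with t h1 h2 h3
        refine mul_le_mul_of_nonneg_right ?_ h1.le
        nlinarith)
    · have hev : ∀ᶠ t in atTop, 1 ≤ 2 * w t * cross (a t) (b t) (d t) (φ t) := by
        rcases hstrong with h' | h'
        -- Here `cross`² = -det > 1/4, so the rate 2 w `cross` of the squared norm eventually
        -- exceeds 1.
        · have : 1 / 2 < cross A B D L := by nlinarith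
          filter_upwards [hw, hc.eventually_const_lt this] with t h2 h3
          nlinarith
        · filter_upwards [h'.eventually_ge_atTop (1 / cross A B D L),
            hc.eventually_const_lt (show cross A B D L / 2 < cross A B D L by linarith)] with t h2 h3
          rw [div_le_iff₀ h] at h2
          have : 0 ≤ w t := by
            by_contra! h0
            nlinarith
          nlinarith
      have := exists_mul_exp_le (κ := 1) hpos hder (by
        filter_upwards [hpos, hev] with t h1 h2
        exact mul_le_mul_of_nonneg_right h2 h1.le)
      simpa using this

/-! ### Existence of solutions on the half-line -/

theorem eq_of_hasDerivAt_zero {f : ℝ → ℝ} (hf : ∀ x, 0 < x → HasDerivAt f 0 x) {x : ℝ}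
    (hx : 0 < x) : f x = f 1 :=
  isOpen_Ioi.is_const_of_deriv_eq_zero isPreconnected_Ioi
    (fun y hy => (hf y hy).differentiableAt.differentiableWithinAt)
    (fun y hy => (hf y hy).deriv) (mem_Ioi.2 hx) (mem_Ioi.2 one_pos)

theorem abs_quad_le (a b d φ : ℝ) : |quad a b d φ| ≤ 2 * (|a| + |b| + |d|) := by
  have hc := Real.abs_cos_le_one φ
  have hs := Real.abs_sin_le_one φ
  have hc0 := abs_nonneg (Real.cos φ)
  have hs0 := abs_nonneg (Real.sin φ)
  have h1 : |Real.cos φ| ^ 2 ≤ 1 := pow_le_one₀ hc0 hc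
  have h2 : |Real.sin φ| ^ 2 ≤ 1 := pow_le_one₀ hs0 hs
  have h3 : |Real.sin φ| * |Real.cos φ| ≤ 1 := mul_le_one₀ hs hc0 hc
  calc |quad a b d φ| ≤ |a| * |Real.cos φ| ^ 2 + 2 * |b| * (|Real.sin φ| * |Real.cos φ|)
        + |d| * |Real.sin φ| ^ 2 := by
        refine (abs_add_three _ _ _).trans (le_of_eq ?_)
        simp only [abs_mul, abs_pow, abs_two]
        ring
    _ ≤ |a| * 1 + 2 * |b| * 1 + |d| * 1 := by gcongr
    _ ≤ _ := by linarith [abs_nonneg a, abs_nonneg d]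

theorem abs_cross_le (a b d φ : ℝ) : |cross a b d φ| ≤ |a| + |b| + |d| := by
  have h := Real.sin_sq_add_cos_sq φ
  have h1 : |Real.cos φ ^ 2 - Real.sin φ ^ 2| ≤ 1 := by
    rw [abs_le]; constructor <;> nlinarith [sq_nonneg (Real.cos φ), sq_nonneg (Real.sin φ)]
  have h2 : |Real.sin φ * Real.cos φ| ≤ 1 := by
    rw [abs_le]; constructor <;>
      nlinarith [sq_nonneg (Real.cos φ + Real.sin φ), sq_nonneg (Real.sin φ - Real.cos φ)]
  calc |cross a b d φ| ≤ |b| * |Real.cos φ ^ 2 - Real.sin φ ^ 2|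
        + |d - a| * |Real.sin φ * Real.cos φ| := by
        refine (abs_add_le _ _).trans (le_of_eq ?_)
        rw [abs_mul, abs_mul (d - a)]
    _ ≤ |b| * 1 + (|d| + |a|) * 1 := by
        gcongr
        exact abs_sub _ _
    _ = _ := by ring

theorem lipschitzWith_quad {a b d K : ℝ} (hK : |a| + |b| + |d| ≤ K) :
    LipschitzWith (2 * K).toNNReal (fun φ => -quad a b d φ) := by
  have hK0 : 0 ≤ K := le_trans (by positivity) hK
  refine lipschitzWith_of_nnnorm_deriv_le
    (fun φ => (hasDerivAt_quad a b d φ).neg.differentiableAt) (fun φ => ?_)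
  have h := (hasDerivAt_quad a b d φ).neg.deriv
  rw [← NNReal.coe_le_coe, coe_nnnorm, Real.coe_toNNReal _ (by positivity)]
  refine h.symm ▸ ?_
  rw [norm_neg, Real.norm_eq_abs, abs_mul, abs_two]
  linarith [abs_cross_le a b d φ]

section Existence

variable {p q r : ℝ → ℝ}

theorem exists_coeff_bound (hp : ContinuousOn p (Ioi 0)) (hq : ContinuousOn q (Ioi 0))
    (hr : ContinuousOn r (Ioi 0)) {m : ℝ} (M : ℝ) (hm : 0 < m) :
    ∃ K, ∀ x ∈ Icc m M, |p x| + |q x| + |r x| ≤ K := by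
  have hc : ContinuousOn (fun x => |p x| + |q x| + |r x|) (Icc m M) :=
    ((hp.abs.add hq.abs).add hr.abs).mono fun x hx => mem_Ioi.2 (hm.trans_le hx.1)
  obtain ⟨K, hK⟩ := isCompact_Icc.bddAbove_image hc
  exact ⟨K, fun x hx => hK ⟨x, hx, rfl⟩⟩

theorem exists_angle_Ioo (hp : ContinuousOn p (Ioi 0)) (hq : ContinuousOn q (Ioi 0))
    (hr : ContinuousOn r (Ioi 0)) (θ₀ : ℝ) {m M : ℝ} (hm : 0 < m) (hm1 : m < 1) (hM : 1 < M) :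
    ∃ θ : ℝ → ℝ, θ 1 = θ₀ ∧
      ∀ x ∈ Ioo m M, HasDerivAt θ (-quad (p x) (q x) (r x) (θ x)) x := by
  obtain ⟨K, hK⟩ := exists_coeff_bound hp hq hr M hm
  have hK0 : 0 ≤ K := le_trans (by positivity) (hK 1 ⟨hm1.le, hM.le⟩)
  have hsub : Icc m M ⊆ Ioi 0 := fun x hx => mem_Ioi.2 (hm.trans_le hx.1)
  -- The field is bounded and Lipschitz in φ, both with constant 2K, on the whole line. A ball of
  -- radius 2K · M is not left during a time at most M, so the solution covers all of [m, M].
  have hPL : IsPicardLindelof (fun x φ => -quad (p x) (q x) (r x) φ)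
      (⟨1, hm1.le, hM.le⟩ : Icc m M) θ₀ ((2 * K).toNNReal * M.toNNReal) 0 (2 * K).toNNReal
      (2 * K).toNNReal :=
    { lipschitzOnWith := fun x hx => (lipschitzWith_quad (hK x hx)).lipschitzOnWith
      continuousOn := fun φ _ =>
        ((((hp.mono hsub).mul continuousOn_const).add
          (((continuousOn_const.mul (hq.mono hsub)).mul continuousOn_const).mul
            continuousOn_const)).add ((hr.mono hsub).mul continuousOn_const)).neg
      norm_le := fun x hx φ _ => by
        rw [norm_neg, Real.norm_eq_abs, Real.coe_toNNReal _ (by positivity)]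
        exact (abs_quad_le _ _ _ _).trans (by linarith [hK x hx])
      mul_max_le := by
        rw [NNReal.coe_mul, NNReal.coe_zero, sub_zero, Real.coe_toNNReal M (by linarith)]
        exact mul_le_mul_of_nonneg_left (max_le (by linarith) (by linarith)) NNReal.zero_le_coe }
  obtain ⟨θ, h1, h2⟩ := hPL.exists_eq_forall_mem_Icc_hasDerivWithinAt₀
  exact ⟨θ, h1, fun x hx => (h2 x (Ioo_subset_Icc_self hx)).hasDerivAt (Icc_mem_nhds hx.1 hx.2)⟩

theorem exists_angle (hp : ContinuousOn p (Ioi 0)) (hq : ContinuousOn q (Ioi 0))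
    (hr : ContinuousOn r (Ioi 0)) (θ₀ : ℝ) :
    ∃ θ : ℝ → ℝ, θ 1 = θ₀ ∧
      ∀ x, 0 < x → HasDerivAt θ (-quad (p x) (q x) (r x) (θ x)) x := by
  -- The shift by 2 keeps 1 strictly inside every interval of the exhaustion, including the one with
  -- n = 0.
  let m : ℕ → ℝ := fun n => 1 / ((n : ℝ) + 2)
  let M : ℕ → ℝ := fun n => (n : ℝ) + 2
  have hm0 : ∀ n, 0 < m n := fun n => by positivity
  have hm1 : ∀ n, m n < 1 := fun n => by
    rw [div_lt_one (by positivity)]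
    linarith [n.cast_nonneg (α := ℝ)]
  have hM1 : ∀ n, 1 < M n := fun n => by
    have := n.cast_nonneg (α := ℝ)
    change 1 < (n : ℝ) + 2
    linarith
  have hsub : ∀ {n k}, n ≤ k → Ioo (m n) (M n) ⊆ Ioo (m k) (M k) := by
    intro n k hnk
    have : (n : ℝ) ≤ k := by exact_mod_cast hnk
    refine Ioo_subset_Ioo ?_ ?_
    · exact one_div_le_one_div_of_le (by positivity) (by linarith)
    · change (n : ℝ) + 2 ≤ k + 2
      linarith
  choose Θ hΘ1 hΘ using fun n => exists_angle_Ioo hp hq hr θ₀ (hm0 n) (hm1 n) (hM1 n)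
  have huniq : ∀ {n k}, n ≤ k → EqOn (Θ n) (Θ k) (Ioo (m n) (M n)) := by
    intro n k hnk
    obtain ⟨K, hK⟩ := exists_coeff_bound hp hq hr (M n) (hm0 n)
    exact ODE_solution_unique_of_mem_Ioo (v := fun x φ => -quad (p x) (q x) (r x) φ)
      (s := fun _ => univ) (t₀ := 1)
      (fun x hx => (lipschitzWith_quad (hK x (Ioo_subset_Icc_self hx))).lipschitzOnWith)
      ⟨hm1 n, hM1 n⟩ (fun x hx => ⟨hΘ n x hx, mem_univ _⟩)
      (fun x hx => ⟨hΘ k x (hsub hnk hx), mem_univ _⟩) ((hΘ1 n).trans (hΘ1 k).symm)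
  let N : ℝ → ℕ := fun x => ⌈max x (1 / x)⌉₊
  have hN : ∀ x, 0 < x → x ∈ Ioo (m (N x)) (M (N x)) := by
    intro x hx
    have h := Nat.le_ceil (max x (1 / x))
    have h1 : x ≤ N x := (le_max_left _ _).trans h
    have h2 : 1 / x ≤ N x := (le_max_right _ _).trans h
    refine ⟨?_, ?_⟩
    · rw [div_lt_iff₀ (by positivity)]
      rw [div_le_iff₀ hx] at h2
      nlinarith
    · change x < (N x : ℝ) + 2
      linarith
  refine ⟨fun x => Θ (N x) x, hΘ1 _, fun x hx => ?_⟩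
  have heq : (fun y => Θ (N y) y) =ᶠ[𝓝 x] Θ (N x) := by
    filter_upwards [isOpen_Ioo.mem_nhds (hN x hx)] with y hy
    have hy0 : 0 < y := (hm0 _).trans hy.1
    rcases le_total (N x) (N y) with h | h
    · exact (huniq h hy).symm
    · exact huniq h (hN y hy0)
  exact (hΘ (N x) x (hN x hx)).congr_of_eventuallyEq heq

/-- Solutions in polar coordinates with prescribed angle at `1`. -/
theorem exists_polar (hp : ContinuousOn p (Ioi 0)) (hq : ContinuousOn q (Ioi 0))
    (hr : ContinuousOn r (Ioi 0)) (θ₀ : ℝ) :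
    ∃ θ ρ : ℝ → ℝ, θ 1 = θ₀ ∧ ρ 1 = 1 ∧ ∀ x, 0 < x → 0 < ρ x ∧
      HasDerivAt θ (-quad (p x) (q x) (r x) (θ x)) x ∧
      SolvesAt p q r (fun x => ρ x * Real.cos (θ x)) (fun x => ρ x * Real.sin (θ x)) x := by
  obtain ⟨θ, hθ1, hθ⟩ := exists_angle hp hq hr θ₀
  have hθc : ContinuousOn θ (Ioi 0) := fun x hx => (hθ x hx).continuousAt.continuousWithinAt
  have hcc : ContinuousOn (fun x => cross (p x) (q x) (r x) (θ x)) (Ioi 0) :=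
    have hc := Real.continuous_cos.comp_continuousOn hθc
    have hs := Real.continuous_sin.comp_continuousOn hθc
    (hq.mul ((hc.pow 2).sub (hs.pow 2))).add ((hr.sub hp).mul (hs.mul hc))
  -- The angle equation does not involve the radius; once θ is known, h = log ρ is a quadrature.
  let h : ℝ → ℝ := fun x => ∫ t in (1 : ℝ)..x, cross (p t) (q t) (r t) (θ t)
  have hh : ∀ x, 0 < x → HasDerivAt h (cross (p x) (q x) (r x) (θ x)) x := by
    intro x hx
    have hsub : uIcc 1 x ⊆ Ioi 0 := fun y hy => lt_of_lt_of_le (lt_min one_pos hx) hy.1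
    exact intervalIntegral.integral_hasDerivAt_right (hcc.mono hsub).intervalIntegrable
      (hcc.stronglyMeasurableAtFilter isOpen_Ioi x hx) (hcc.continuousAt (Ioi_mem_nhds hx))
  refine ⟨θ, fun x => Real.exp (h x), hθ1, by simp [h], fun x hx => ⟨Real.exp_pos _, hθ x hx, ?_⟩⟩
  have hsc := Real.sin_sq_add_cos_sq (θ x)
  constructor
  · refine ((hh x hx).exp.mul (hθ x hx).cos).congr_deriv ?_
    simp only [quad, cross]
    linear_combination Real.exp (h x) * (q x * Real.cos (θ x) + r x * Real.sin (θ x)) * hsc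
  · refine ((hh x hx).exp.mul (hθ x hx).sin).congr_deriv ?_
    simp only [quad, cross]
    linear_combination -Real.exp (h x) * (p x * Real.cos (θ x) + q x * Real.sin (θ x)) * hsc

/-- Two solutions with vanishing Wronskian are proportional. -/
theorem exists_eq_const_mul {u₁ v₁ u₂ v₂ : ℝ → ℝ}
    (h₁ : ∀ x, 0 < x → SolvesAt p q r u₁ v₁ x) (h₂ : ∀ x, 0 < x → SolvesAt p q r u₂ v₂ x)
    (hpos : ∀ x, 0 < x → 0 < u₁ x ^ 2 + v₁ x ^ 2)
    (hW : ∀ x, 0 < x → u₁ x * v₂ x - u₂ x * v₁ x = 0) :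
    ∃ c, ∀ x, 0 < x → u₂ x = c * u₁ x ∧ v₂ x = c * v₁ x := by
  have hd : ∀ x, 0 < x → HasDerivAt
      (fun t => (u₁ t * u₂ t + v₁ t * v₂ t) / (u₁ t ^ 2 + v₁ t ^ 2)) 0 x := by
    intro x hx
    have := (h₁ x hx).hasDerivAt_ratio (h₂ x hx) (hpos x hx).ne'
    rwa [hW x hx, zero_mul, zero_div] at this
  refine ⟨(u₁ 1 * u₂ 1 + v₁ 1 * v₂ 1) / (u₁ 1 ^ 2 + v₁ 1 ^ 2), fun x hx => ?_⟩
  rw [← eq_of_hasDerivAt_zero hd hx]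
  have h0 := (hpos x hx).ne'
  constructor
  · field_simp
    linear_combination -v₁ x * hW x hx
  · field_simp
    linear_combination u₁ x * hW x hx

theorem wronskian_eq {u₁ v₁ u₂ v₂ : ℝ → ℝ}
    (h₁ : ∀ x, 0 < x → SolvesAt p q r u₁ v₁ x) (h₂ : ∀ x, 0 < x → SolvesAt p q r u₂ v₂ x)
    {x : ℝ} (hx : 0 < x) : u₁ x * v₂ x - u₂ x * v₁ x = u₁ 1 * v₂ 1 - u₂ 1 * v₁ 1 :=
  eq_of_hasDerivAt_zero (f := fun x => u₁ x * v₂ x - u₂ x * v₁ x)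
    (fun y hy => (h₁ y hy).hasDerivAt_wronskian (h₂ y hy)) hx

/-- `ρ` and `θ` are polar coordinates of the solution `(u, v)`. -/
structure IsPolar (p q r u v ρ θ : ℝ → ℝ) : Prop where
  pos : ∀ x, 0 < x → 0 < ρ x
  fst_eq : ∀ x, 0 < x → u x = ρ x * Real.cos (θ x)
  snd_eq : ∀ x, 0 < x → v x = ρ x * Real.sin (θ x)
  hasDerivAt : ∀ x, 0 < x → HasDerivAt θ (-quad (p x) (q x) (r x) (θ x)) x

theorem IsPolar.normSq {u v ρ θ : ℝ → ℝ} (h : IsPolar p q r u v ρ θ) {x : ℝ} (hx : 0 < x) :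
    u x ^ 2 + v x ^ 2 = ρ x ^ 2 := by
  rw [h.fst_eq x hx, h.snd_eq x hx]
  linear_combination ρ x ^ 2 * Real.sin_sq_add_cos_sq (θ x)

theorem IsPolar.normSq_pos {u v ρ θ : ℝ → ℝ} (h : IsPolar p q r u v ρ θ) {x : ℝ} (hx : 0 < x) :
    0 < u x ^ 2 + v x ^ 2 := by
  rw [h.normSq hx]
  exact pow_pos (h.pos x hx) 2

/-- The solution is compared with the polar solution having the same argument at 1. Their Wronskian
vanishes, so they are proportional, and the factor is the radius at 1, hence nonnegative: the angle
needs no correction. -/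
theorem exists_isPolar (hp : ContinuousOn p (Ioi 0)) (hq : ContinuousOn q (Ioi 0))
    (hr : ContinuousOn r (Ioi 0)) {u v : ℝ → ℝ} (h : ∀ x, 0 < x → SolvesAt p q r u v x)
    (hne : ∃ x, 0 < x ∧ (u x ≠ 0 ∨ v x ≠ 0)) : ∃ ρ θ, IsPolar p q r u v ρ θ := by
  obtain ⟨θ₀, R, hR, hu1, hv1⟩ : ∃ θ₀ R : ℝ, 0 ≤ R ∧ u 1 = R * Real.cos θ₀ ∧
      v 1 = R * Real.sin θ₀ :=
    ⟨_, _, norm_nonneg _, (Complex.norm_mul_cos_arg ⟨u 1, v 1⟩).symm,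
      (Complex.norm_mul_sin_arg ⟨u 1, v 1⟩).symm⟩
  obtain ⟨θ, ρ, hθ1, hρ1, hP⟩ := exists_polar hp hq hr θ₀
  have hs := fun x hx => (hP x hx).2.2
  obtain ⟨c, hc⟩ := exists_eq_const_mul hs h
    (fun x hx => by
      have := (hP x hx).1
      have e : (ρ x * Real.cos (θ x)) ^ 2 + (ρ x * Real.sin (θ x)) ^ 2 = ρ x ^ 2 := by
        linear_combination ρ x ^ 2 * Real.sin_sq_add_cos_sq (θ x)
      rw [e]
      positivity)
    (fun x hx => by
      rw [wronskian_eq hs h hx]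
      simp only [hθ1, hρ1, hu1, hv1]
      ring)
  have hcR : c = R := by
    obtain ⟨e1, e2⟩ := hc 1 one_pos
    simp only [hθ1, hρ1, hu1, hv1] at e1 e2
    linear_combination (R - c) * Real.sin_sq_add_cos_sq θ₀ - Real.cos θ₀ * e1 - Real.sin θ₀ * e2
  have hc0 : c ≠ 0 := by
    rintro rfl
    obtain ⟨x, hx, h0⟩ := hne
    have := hc x hx
    simp only [zero_mul] at this
    rcases h0 with h0 | h0
    exacts [h0 this.1, h0 this.2]
  have hcpos : 0 < c := lt_of_le_of_ne (hcR ▸ hR) hc0.symm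
  exact ⟨fun x => c * ρ x, θ, fun x hx => mul_pos hcpos (hP x hx).1,
    fun x hx => by rw [(hc x hx).1, mul_assoc], fun x hx => by rw [(hc x hx).2, mul_assoc],
    fun x hx => (hP x hx).2.1⟩

end Existence

/-! ### Classical form of the differential equation -/

theorem toLpLin_apply_zero (M : Matrix (Fin 2) (Fin 2) ℝ) (z : Plane) :
    Matrix.toLpLin 2 2 M z 0 = M 0 0 * z 0 + M 0 1 * z 1 := by
  simp [Matrix.toLpLin_apply]

theorem toLpLin_apply_one (M : Matrix (Fin 2) (Fin 2) ℝ) (z : Plane) :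
    Matrix.toLpLin 2 2 M z 1 = M 1 0 * z 0 + M 1 1 * z 1 := by
  simp [Matrix.toLpLin_apply]

theorem norm_sq_plane (z : Plane) : ‖z‖ ^ 2 = z 0 ^ 2 + z 1 ^ 2 := by
  rw [EuclideanSpace.real_norm_sq_eq, Fin.sum_univ_two]

theorem plane_ext {z w : Plane} (h0 : z 0 = w 0) (h1 : z 1 = w 1) : z = w := by
  ext i
  fin_cases i
  exacts [h0, h1]

theorem hasDerivAt_plane_apply {z : ℝ → Plane} {z' : Plane} {x : ℝ} (h : HasDerivAt z z' x)
    (i : Fin 2) : HasDerivAt (fun x => z x i) (z' i) x :=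
  (PiLp.hasFDerivAt_apply (𝕜 := ℝ) 2 (z x) i).comp_hasDerivAt x h

theorem hasDerivAt_plane {z : ℝ → Plane} {u' v' : ℝ} {x : ℝ}
    (h0 : HasDerivAt (fun x => z x 0) u' x) (h1 : HasDerivAt (fun x => z x 1) v' x) :
    HasDerivAt z !₂[u', v'] x := by
  have h : HasDerivAt (fun x => (z x).ofLp) ![u', v'] x := by
    rw [hasDerivAt_pi]
    intro i
    fin_cases i
    exacts [h0, h1]
  exact (PiLp.hasFDerivAt_toLp (𝕜 := ℝ) 2 (z x).ofLp).comp_hasDerivAt x h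

theorem absolutelyContinuousOnInterval_plane_apply {z : ℝ → Plane} {a b : ℝ}
    (h : AbsolutelyContinuousOnInterval z a b) (i : Fin 2) :
    AbsolutelyContinuousOnInterval (fun x => z x i) a b := by
  rw [absolutelyContinuousOnInterval_iff] at h ⊢
  intro ε hε
  obtain ⟨δ, hδ, H⟩ := h ε hε
  refine ⟨δ, hδ, fun E hE hlt => lt_of_le_of_lt (Finset.sum_le_sum fun j _ => ?_) (H E hE hlt)⟩
  rw [dist_eq_norm, dist_eq_norm, ← PiLp.sub_apply]
  exact PiLp.norm_apply_le _ i

/-- A locally absolutely continuous function whose derivative is almost everywhere equal to a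
continuous function is continuously differentiable. -/
theorem hasDerivAt_of_ae_deriv_eq {u f : ℝ → ℝ}
    (hu : ∀ a b : ℝ, 0 < a → a ≤ b → AbsolutelyContinuousOnInterval u a b)
    (hf : ContinuousOn f (Ioi 0)) (h : ∀ᵐ x ∂(volume.restrict (Ioi (0 : ℝ))), deriv u x = f x)
    {x : ℝ} (hx : 0 < x) : HasDerivAt u (f x) x := by
  -- The base point x / 2 leaves a full neighbourhood of x on which the fundamental theorem for
  -- absolutely continuous functions applies.
  have hx2 : 0 < x / 2 := by linarith
  have hsub : ∀ y, x / 2 ≤ y → uIcc (x / 2) y ⊆ Ioi 0 := fun y hy t ht => by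
    rw [uIcc_of_le hy] at ht
    exact hx2.trans_le ht.1
  have hint : HasDerivAt (fun y => ∫ t in (x / 2)..y, f t) (f x) x :=
    intervalIntegral.integral_hasDerivAt_right
      (hf.mono (hsub x (by linarith))).intervalIntegrable
      (hf.stronglyMeasurableAtFilter isOpen_Ioi x hx) (hf.continuousAt (Ioi_mem_nhds hx))
  refine (hint.const_add (u (x / 2))).congr_of_eventuallyEq ?_
  filter_upwards [Ioi_mem_nhds (show x / 2 < x by linarith)] with y hy
  have hy' : x / 2 ≤ y := le_of_lt hy
  have h1 := (hu _ _ hx2 hy').integral_deriv_eq_sub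
  have h2 : ∫ t in (x / 2)..y, deriv u t = ∫ t in (x / 2)..y, f t := by
    refine intervalIntegral.integral_congr_ae ?_
    rw [ae_restrict_iff' measurableSet_Ioi] at h
    filter_upwards [h] with t ht htm
    exact ht (hsub y hy' (uIoc_subset_uIcc htm))
  rw [← h2, h1]
  ring

section Coefficients

variable {μm μp : ℝ} {P : ℝ → Matrix (Fin 2) (Fin 2) ℝ}

theorem CoefficientClass.continuousOn_apply (hP : CoefficientClass μm μp P) (i j : Fin 2) :
    ContinuousOn (fun x => P x i j) (Ioi 0) :=
  (continuous_apply_apply i j).comp_continuousOn hP.continuousOn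

theorem CoefficientClass.continuousOn_sub (hP : CoefficientClass μm μp P) (i j : Fin 2)
    (lam : ℝ) : ContinuousOn (fun x => P x i j - lam) (Ioi 0) :=
  (hP.continuousOn_apply i j).sub continuousOn_const

/-- The components of `z` solve the system `J z' + P z = lam z` in the classical sense at `x`. -/
def SolvesDirac (P : ℝ → Matrix (Fin 2) (Fin 2) ℝ) (lam : ℝ) (u v : ℝ → ℝ) (x : ℝ) : Prop :=
  SolvesAt (fun x => P x 0 0 - lam) (fun x => P x 0 1) (fun x => P x 1 1 - lam) u v x

theorem IsSolution.solvesDirac {lam : ℝ} {z : ℝ → Plane} (hP : CoefficientClass μm μp P)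
    (hz : IsSolution P lam z) {x : ℝ} (hx : 0 < x) :
    SolvesDirac P lam (fun x => z x 0) (fun x => z x 1) x := by
  have hz0 : ContinuousOn (fun x => z x 0) (Ioi 0) :=
    (EuclideanSpace.proj (0 : Fin 2)).continuous.comp_continuousOn hz.1.continuousOn
  have hz1 : ContinuousOn (fun x => z x 1) (Ioi 0) :=
    (EuclideanSpace.proj (1 : Fin 2)).continuous.comp_continuousOn hz.1.continuousOn
  have hae : ∀ᵐ x ∂(volume.restrict (Ioi (0 : ℝ))),
      deriv (fun x => z x 0) x = P x 0 1 * z x 0 + (P x 1 1 - lam) * z x 1 ∧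
      deriv (fun x => z x 1) x = -((P x 0 0 - lam) * z x 0) - P x 0 1 * z x 1 := by
    filter_upwards [hz.2, hz.1.ae_differentiableAt, ae_restrict_mem measurableSet_Ioi]
      with x h hd hx
    have e0 := congrArg (fun w : Plane => w 0) h
    have e1 := congrArg (fun w : Plane => w 1) h
    simp only [tau, PiLp.add_apply, PiLp.smul_apply, toLpLin_apply_zero, toLpLin_apply_one, J,
      Matrix.of_apply, Matrix.cons_val', Matrix.cons_val_zero, Matrix.cons_val_one,
      Matrix.cons_val_fin_one, smul_eq_mul] at e0 e1
    have hs : P x 1 0 = P x 0 1 := (hP.symm x hx).apply 0 1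
    rw [(hasDerivAt_plane_apply hd.hasDerivAt 0).deriv,
      (hasDerivAt_plane_apply hd.hasDerivAt 1).deriv]
    rw [hs] at e1
    constructor <;> linarith
  exact ⟨hasDerivAt_of_ae_deriv_eq
      (fun a b ha hab => absolutelyContinuousOnInterval_plane_apply (hz.1 a b ha hab) 0)
      (((hP.continuousOn_apply 0 1).mul hz0).add ((hP.continuousOn_sub 1 1 lam).mul hz1))
      (hae.mono fun x h => h.1) hx,
    hasDerivAt_of_ae_deriv_eq
      (fun a b ha hab => absolutelyContinuousOnInterval_plane_apply (hz.1 a b ha hab) 1)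
      (((hP.continuousOn_sub 0 0 lam).mul hz0).neg.sub ((hP.continuousOn_apply 0 1).mul hz1))
      (hae.mono fun x h => h.2) hx⟩

theorem isSolution_of_solvesDirac {lam : ℝ} {z : ℝ → Plane} (hP : CoefficientClass μm μp P)
    (h : ∀ x, 0 < x → SolvesDirac P lam (fun x => z x 0) (fun x => z x 1) x) :
    IsSolution P lam z := by
  have hd : ∀ x, 0 < x → HasDerivAt z
      !₂[P x 0 1 * z x 0 + (P x 1 1 - lam) * z x 1,
        -((P x 0 0 - lam) * z x 0) - P x 0 1 * z x 1] x :=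
    fun x hx => hasDerivAt_plane (h x hx).1 (h x hx).2
  have hz0 : ContinuousOn (fun x => z x 0) (Ioi 0) :=
    fun x hx => (h x hx).1.continuousAt.continuousWithinAt
  have hz1 : ContinuousOn (fun x => z x 1) (Ioi 0) :=
    fun x hx => (h x hx).2.continuousAt.continuousWithinAt
  constructor
  · intro a b ha hab
    have hsub : Icc a b ⊆ Ioi 0 := fun x hx => mem_Ioi.2 (ha.trans_le hx.1)
    have hc : ContinuousOn (fun x => (!₂[P x 0 1 * z x 0 + (P x 1 1 - lam) * z x 1,
        -((P x 0 0 - lam) * z x 0) - P x 0 1 * z x 1] : Plane)) (Icc a b) := by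
      refine ContinuousOn.mono ?_ hsub
      refine (PiLp.continuous_toLp 2 _).comp_continuousOn (continuousOn_pi.2 fun i => ?_)
      fin_cases i
      · exact ((hP.continuousOn_apply 0 1).mul hz0).add ((hP.continuousOn_sub 1 1 lam).mul hz1)
      · exact ((hP.continuousOn_sub 0 0 lam).mul hz0).neg.sub ((hP.continuousOn_apply 0 1).mul hz1)
    -- The derivative is bounded on compact intervals, so z is Lipschitz there, hence absolutely
    -- continuous.
    obtain ⟨K, hK⟩ := isCompact_Icc.exists_bound_of_continuousOn hc
    refine LipschitzOnWith.absolutelyContinuousOnInterval (K := K.toNNReal) ?_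
    rw [uIcc_of_le hab]
    refine (convex_Icc a b).lipschitzOnWith_of_nnnorm_hasDerivWithin_le
      (fun x hx => (hd x (hsub hx)).hasDerivWithinAt) (fun x hx => ?_)
    rw [← NNReal.coe_le_coe, coe_nnnorm]
    exact (hK x hx).trans (Real.le_coe_toNNReal K)
  · filter_upwards [ae_restrict_mem measurableSet_Ioi] with x hx
    have hs : P x 1 0 = P x 0 1 := (hP.symm x hx).apply 0 1
    refine plane_ext ?_ ?_
    · simp only [tau, (hd x hx).deriv, PiLp.add_apply, PiLp.smul_apply, toLpLin_apply_zero, J,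
        Matrix.of_apply, Matrix.cons_val', Matrix.cons_val_zero, Matrix.cons_val_one,
        Matrix.cons_val_fin_one, smul_eq_mul]
      ring
    · simp only [tau, (hd x hx).deriv, PiLp.add_apply, PiLp.smul_apply, toLpLin_apply_one, J,
        Matrix.of_apply, Matrix.cons_val', Matrix.cons_val_zero, Matrix.cons_val_one,
        Matrix.cons_val_fin_one, smul_eq_mul, hs]
      ring

/-! ### Square integrable solutions -/

/-- Passes between L² classes and continuous representatives; a continuous function that vanishes
almost everywhere on (0, ∞) vanishes there identically. -/
theorem isEigenvalue_A0_iff (P : ℝ → Matrix (Fin 2) (Fin 2) ℝ) (lam : ℝ) :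
    IsEigenvalue (A0 P) lam ↔ ∃ z : ℝ → Plane, IsSolution P lam z ∧ (∃ x, 0 < x ∧ z x ≠ 0) ∧
      MemLp z 2 (volume.restrict (Ioi (0 : ℝ))) := by
  constructor
  · rintro ⟨f, hf0, hf⟩
    have hg : ((f : L2), A0 P f) ∈ (A0 P).graph := (A0 P).mem_graph f
    rw [A0_graph, hf] at hg
    obtain ⟨z, hz, h1, h2⟩ := hg
    refine ⟨z, ⟨hz, ?_⟩, ?_, (Lp.memLp (f : L2)).ae_eq h1⟩
    · filter_upwards [h1, h2, Lp.coeFn_smul lam (f : L2)] with x e1 e2 e3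
      rw [← e2, e3, Pi.smul_apply, e1]
    · by_contra! h
      refine hf0 ((Lp.eq_zero_iff_ae_eq_zero).2 ?_)
      filter_upwards [h1, ae_restrict_mem measurableSet_Ioi] with x e1 hx
      rw [e1, h x hx, Pi.zero_apply]
  · rintro ⟨z, hz, ⟨x, hx, hzx⟩, hL⟩
    have h1 := hL.coeFn_toLp
    have hg : (hL.toLp z, lam • hL.toLp z) ∈ (A0 P).graph := by
      rw [A0_graph]
      refine ⟨z, hz.1, h1, ?_⟩
      filter_upwards [h1, hz.2, Lp.coeFn_smul lam (hL.toLp z)] with x e1 e2 e3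
      rw [e3, e2, Pi.smul_apply, e1]
    obtain ⟨f, hf1, hf2⟩ := (LinearPMap.mem_graph_iff _).1 hg
    refine ⟨f, fun h0 => hzx ?_, ?_⟩
    · rw [hf1] at h0
      have hz0 : z =ᵐ[volume.restrict (Ioi (0 : ℝ))] 0 :=
        h1.symm.trans ((Lp.eq_zero_iff_ae_eq_zero).1 h0)
      exact Measure.eqOn_open_of_ae_eq hz0 isOpen_Ioi hz.1.continuousOn continuousOn_const hx
    · rw [hf2, hf1]

end Coefficients

theorem not_integrableOn_of_const_le {R : ℝ → ℝ} {C : ℝ} (hC : 0 < C)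
    (h : ∀ᶠ x in atTop, C ≤ R x) : ¬ IntegrableOn R (Ioi 0) := by
  intro hR
  obtain ⟨T, hT⟩ := eventually_atTop.1 h
  have h1 : IntegrableOn (fun _ : ℝ => C) (Ioi (max T 0)) := by
    refine Integrable.mono' (hR.mono_set (Ioi_subset_Ioi (le_max_right _ _)))
      aestronglyMeasurable_const ?_
    filter_upwards [ae_restrict_mem measurableSet_Ioi] with x hx
    rw [Real.norm_of_nonneg hC.le]
    exact hT x ((le_max_left _ _).trans (le_of_lt hx))
  rw [integrableOn_const_iff] at h1
  simp [hC.ne'] at h1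

theorem not_integrableOn_of_inv_le {R : ℝ → ℝ} {C : ℝ} (hC : 0 < C)
    (h : ∀ᶠ x in 𝓝[>] 0, C * x⁻¹ ≤ R x) : ¬ IntegrableOn R (Ioi 0) := by
  intro hR
  obtain ⟨δ, hδ, hδR⟩ := mem_nhdsGT_iff_exists_Ioc_subset.1 h
  have h1 : IntegrableOn (fun x : ℝ => C * x⁻¹) (Ioc 0 δ) := by
    refine Integrable.mono' (hR.mono_set Ioc_subset_Ioi_self)
      (measurable_inv.const_mul C).aestronglyMeasurable ?_
    filter_upwards [ae_restrict_mem measurableSet_Ioc] with x hx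
    rw [Real.norm_of_nonneg (mul_nonneg hC.le (inv_nonneg.2 hx.1.le))]
    exact hδR hx
  have h2 : IntegrableOn (fun x : ℝ => x⁻¹) (Ioc 0 δ) := by
    have := Integrable.const_mul h1 C⁻¹
    simp only [← mul_assoc, inv_mul_cancel₀ hC.ne', one_mul] at this
    exact this
  have h3 := (intervalIntegrable_iff_integrableOn_Ioc_of_le (le_of_lt hδ)).2 h2
  rw [intervalIntegrable_inv_iff] at h3
  rcases h3 with h3 | h3
  · exact (ne_of_lt hδ) h3
  · exact h3 left_mem_uIcc

theorem integrableOn_Ioi_of_bound {R : ℝ → ℝ} {κ C L : ℝ} (hκ : 0 < κ)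
    (hc : ContinuousOn R (Ioi 0)) (h0 : Tendsto R (𝓝[>] 0) (𝓝 L))
    (hR : ∀ x, 0 < x → 0 ≤ R x)
    (h : ∀ᶠ x in atTop, R x ≤ C * Real.exp (-(κ * x))) : IntegrableOn R (Ioi 0) := by
  obtain ⟨T, hT⟩ := eventually_atTop.1 (h.and (eventually_ge_atTop 1))
  have hT1 : 1 ≤ T := (hT T le_rfl).2
  have hT0 : 0 < T := by linarith
  rw [← Ioc_union_Ioi_eq_Ioi hT0.le]
  refine IntegrableOn.union ?_ ?_
  -- Giving R the value L at 0 makes it continuous on a compact interval, hence integrable near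
  -- zero.
  · have hd : ContinuousOn (Function.update R 0 L) (Icc 0 T) := by
      intro x hx
      rcases hx.1.eq_or_lt with rfl | hx0
      · rw [continuousWithinAt_update_same]
        exact h0.mono_left (nhdsWithin_mono _ fun y hy => lt_of_le_of_ne hy.1.1 (Ne.symm hy.2))
      · have : R =ᶠ[𝓝 x] Function.update R 0 L := by
          filter_upwards [Ioi_mem_nhds hx0] with y hy
          rw [Function.update_of_ne (ne_of_gt hy)]
        exact ((hc.continuousAt (Ioi_mem_nhds hx0)).congr this).continuousWithinAt
    refine (hd.integrableOn_Icc.mono_set Ioc_subset_Icc_self).congr_fun (fun x hx => ?_)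
      measurableSet_Ioc
    rw [Function.update_of_ne (ne_of_gt hx.1)]
  · have h1 : IntegrableOn (fun x => C * Real.exp (-κ * x)) (Ioi T) :=
      (exp_neg_integrableOn_Ioi T hκ).const_mul C
    refine Integrable.mono' h1 ((hc.mono (Ioi_subset_Ioi hT0.le)).aestronglyMeasurable
      measurableSet_Ioi) ?_
    filter_upwards [ae_restrict_mem measurableSet_Ioi] with x hx
    rw [Real.norm_of_nonneg (hR x (hT0.trans hx)), neg_mul]
    exact (hT x (le_of_lt hx)).1

theorem memLp_plane_iff {z : ℝ → Plane} (hz : ContinuousOn z (Ioi 0)) :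
    MemLp z 2 (volume.restrict (Ioi (0 : ℝ))) ↔
      IntegrableOn (fun x => z x 0 ^ 2 + z x 1 ^ 2) (Ioi 0) := by
  rw [memLp_two_iff_integrable_sq_norm (hz.aestronglyMeasurable measurableSet_Ioi)]
  simp only [norm_sq_plane]
  rfl

theorem tendsto_zero_of_sq {ι : Type*} {l : Filter ι} {f : ι → ℝ}
    (h : Tendsto (fun i => f i ^ 2) l (𝓝 0)) : Tendsto f l (𝓝 0) := by
  have := (Real.continuous_sqrt.tendsto 0).comp h
  rw [Real.sqrt_zero] at this
  exact (tendsto_zero_iff_abs_tendsto_zero f).2 (this.congr fun i => Real.sqrt_sq_eq_abs (f i))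

/-! ### The behaviour of solutions at infinity and at zero -/

section Alternatives

variable {μm μp lam : ℝ} {P : ℝ → Matrix (Fin 2) (Fin 2) ℝ}

theorem alternative_at_infinity (hP : CoefficientClass μm μp P) (hlam : lam ∈ Ioo μm μp)
    {u v ρ θ : ℝ → ℝ} (hs : ∀ x, 0 < x → SolvesDirac P lam u v x)
    (hpol : IsPolar (fun x => P x 0 0 - lam) (fun x => P x 0 1) (fun x => P x 1 1 - lam) u v ρ θ) :
    ∃ L, Tendsto θ atTop (𝓝 L) ∧ quad (μm - lam) 0 (μp - lam) L = 0 ∧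
      ((cross (μm - lam) 0 (μp - lam) L < 0 ∧
          ∃ κ > 0, ∃ C > 0, ∀ᶠ x in atTop, u x ^ 2 + v x ^ 2 ≤ C * Real.exp (-(κ * x))) ∨
        (0 < cross (μm - lam) 0 (μp - lam) L ∧ ∃ C > 0, ∀ᶠ x in atTop, C ≤ u x ^ 2 + v x ^ 2)) := by
  obtain ⟨q, -, hlim, -⟩ := hP.at_infinity
  have hent : ∀ i j, Tendsto (fun x => P x i j) atTop
      (𝓝 ((!![μm, 0; 0, μp] : Matrix (Fin 2) (Fin 2) ℝ) i j)) := fun i j =>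
    ((continuous_apply_apply i j).tendsto _).comp hlim
  have hev := eventually_gt_atTop (0 : ℝ)
  obtain ⟨L, hL, hq, h⟩ := angle_limit_dichotomy (w := fun _ => 1) (u := u) (v := v) (ρ := ρ)
    ((hent 0 0).sub_const lam) (hent 0 1) ((hent 1 1).sub_const lam)
    (Eventually.of_forall fun _ => le_rfl)
    (by
      have h1 := hlam.1
      have h2 := hlam.2
      simp only [Matrix.of_apply, Matrix.cons_val', Matrix.cons_val_zero, Matrix.cons_val_one,
        Matrix.cons_val_fin_one]
      nlinarith)
    (by simp only [one_mul]; exact hev.mono hs) (hev.mono hpol.pos) (hev.mono hpol.fst_eq)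
    (hev.mono hpol.snd_eq) (by simpa only [one_mul] using hev.mono hpol.hasDerivAt)
  refine ⟨L, hL, hq, ?_⟩
  rcases h with h | ⟨h1, -, ⟨κ, hκ, C, hC, h2⟩, -⟩
  · exact Or.inl h
  · refine Or.inr ⟨h1, C, hC, ?_⟩
    filter_upwards [h2, hev] with x h3 hx
    refine le_trans ?_ h3
    have : 1 ≤ Real.exp (κ * x) := Real.one_le_exp (by positivity)
    nlinarith

/-- In the variable `t = -log x` the system is asymptotically constant up to a scalar factor. -/
theorem CoefficientClass.exists_log_coefficients (hP : CoefficientClass μm μp P) (lam : ℝ) :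
    ∃ (a b d w : ℝ → ℝ) (A B D : ℝ), Tendsto a atTop (𝓝 A) ∧ Tendsto b atTop (𝓝 B) ∧
      Tendsto d atTop (𝓝 D) ∧ (∀ᶠ t in atTop, 1 ≤ w t) ∧ A * D - B ^ 2 < 0 ∧
      (A * D - B ^ 2 < -1 / 4 ∨ Tendsto w atTop atTop) ∧
      (∀ t, w t * a t = -(Real.exp (-t) * (P (Real.exp (-t)) 0 0 - lam))) ∧
      (∀ t, w t * b t = -(Real.exp (-t) * P (Real.exp (-t)) 0 1)) ∧
      (∀ t, w t * d t = -(Real.exp (-t) * (P (Real.exp (-t)) 1 1 - lam))) := by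
  obtain ⟨β, Q, q, hβ, hQ, -, hlim, -, hdet1, hdet2⟩ := hP.at_zero
  have hexp : Tendsto (fun t : ℝ => Real.exp (-t)) atTop (𝓝[>] 0) :=
    tendsto_nhdsWithin_iff.2 ⟨Real.tendsto_exp_neg_atTop_nhds_zero,
      Eventually.of_forall fun t => Real.exp_pos _⟩
  have hent : ∀ i j, Tendsto (fun t => Real.exp (-t) ^ β * P (Real.exp (-t)) i j) atTop
      (𝓝 (Q i j)) := fun i j => ((continuous_apply_apply i j).tendsto _).comp (hlim.comp hexp)
  have hpow : Tendsto (fun t => Real.exp (-t) ^ β * lam) atTop (𝓝 0) := by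
    have h1 : Tendsto (fun x : ℝ => x ^ β) (𝓝 0) (𝓝 (0 ^ β)) :=
      (Real.continuousAt_rpow_const 0 β (Or.inr (by linarith))).tendsto
    rw [Real.zero_rpow (by linarith)] at h1
    simpa using ((h1.comp Real.tendsto_exp_neg_atTop_nhds_zero).mul_const lam)
  have hdiag : ∀ i, Tendsto (fun t => -(Real.exp (-t) ^ β * (P (Real.exp (-t)) i i - lam))) atTop
      (𝓝 (-Q i i)) := fun i => by
    have := ((hent i i).sub hpow).neg
    rw [sub_zero] at this
    exact this.congr fun t => by ring
  have hw : ∀ t, Real.exp ((β - 1) * t) * Real.exp (-t) ^ β = Real.exp (-t) := fun t => by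
    rw [← Real.exp_mul, ← Real.exp_add]
    ring_nf
  have hQdet : -Q 0 0 * -Q 1 1 - (-Q 0 1) ^ 2 = Q.det := by
    rw [Matrix.det_fin_two, hQ.apply 0 1]
    ring
  -- With x = exp(-t), the chain-rule factor -x is split as x^(1-β) · (-x^β): the weight is x^(1-β)
  -- = exp((β-1)t), and -x^β (P - λ) tends to -P*, which has the same determinant as P*.
  refine ⟨fun t => -(Real.exp (-t) ^ β * (P (Real.exp (-t)) 0 0 - lam)),
    fun t => -(Real.exp (-t) ^ β * P (Real.exp (-t)) 0 1),
    fun t => -(Real.exp (-t) ^ β * (P (Real.exp (-t)) 1 1 - lam)),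
    fun t => Real.exp ((β - 1) * t), -Q 0 0, -Q 0 1, -Q 1 1, hdiag 0, (hent 0 1).neg, hdiag 1,
    ?_, ?_, ?_, fun t => ?_, fun t => ?_, fun t => ?_⟩
  · filter_upwards [eventually_ge_atTop 0] with t ht
    exact Real.one_le_exp (mul_nonneg (by linarith) ht)
  · rw [hQdet]
    rcases hβ.eq_or_lt with h | h
    · linarith [hdet1 h.symm]
    · exact hdet2 h
  · rw [hQdet]
    rcases hβ.eq_or_lt with h | h
    · exact Or.inl (hdet1 h.symm)
    · exact Or.inr (Real.tendsto_exp_atTop.comp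
        (tendsto_id.const_mul_atTop (show 0 < β - 1 by linarith)))
  · linear_combination -(P (Real.exp (-t)) 0 0 - lam) * hw t
  · linear_combination -(P (Real.exp (-t)) 0 1) * hw t
  · linear_combination -(P (Real.exp (-t)) 1 1 - lam) * hw t

theorem tendsto_neg_log_nhdsGT_zero : Tendsto (fun x : ℝ => -Real.log x) (𝓝[>] 0) atTop :=
  tendsto_neg_atBot_atTop.comp Real.tendsto_log_nhdsGT_zero

theorem tendsto_nhdsGT_zero_of_comp_exp_neg {f : ℝ → ℝ} {l : Filter ℝ}
    (h : Tendsto (fun t => f (Real.exp (-t))) atTop l) : Tendsto f (𝓝[>] 0) l := by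
  refine (h.comp tendsto_neg_log_nhdsGT_zero).congr' ?_
  filter_upwards [self_mem_nhdsWithin] with x hx
  simp only [Function.comp, neg_neg, Real.exp_log (mem_Ioi.1 hx)]

theorem SolvesDirac.comp_exp_neg {a b d w u v : ℝ → ℝ}
    (ha : ∀ t, w t * a t = -(Real.exp (-t) * (P (Real.exp (-t)) 0 0 - lam)))
    (hb : ∀ t, w t * b t = -(Real.exp (-t) * P (Real.exp (-t)) 0 1))
    (hd : ∀ t, w t * d t = -(Real.exp (-t) * (P (Real.exp (-t)) 1 1 - lam)))
    (hs : ∀ x, 0 < x → SolvesDirac P lam u v x) (t : ℝ) :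
    SolvesAt (fun t => w t * a t) (fun t => w t * b t) (fun t => w t * d t)
      (fun t => u (Real.exp (-t))) (fun t => v (Real.exp (-t))) t := by
  simp only [ha, hb, hd]
  exact SolvesAt.comp_exp_neg (hs _ (Real.exp_pos _)) rfl

theorem IsPolar.hasDerivAt_comp_exp_neg {a b d w u v ρ θ : ℝ → ℝ}
    (ha : ∀ t, w t * a t = -(Real.exp (-t) * (P (Real.exp (-t)) 0 0 - lam)))
    (hb : ∀ t, w t * b t = -(Real.exp (-t) * P (Real.exp (-t)) 0 1))
    (hd : ∀ t, w t * d t = -(Real.exp (-t) * (P (Real.exp (-t)) 1 1 - lam)))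
    (hpol : IsPolar (fun x => P x 0 0 - lam) (fun x => P x 0 1) (fun x => P x 1 1 - lam) u v ρ θ)
    (t : ℝ) : HasDerivAt (fun t => θ (Real.exp (-t)))
      (-(w t * quad (a t) (b t) (d t) (θ (Real.exp (-t))))) t := by
  have he : HasDerivAt (fun t : ℝ => Real.exp (-t)) (Real.exp (-t) * (-1)) t :=
    (hasDerivAt_neg t).exp
  refine ((hpol.hasDerivAt (Real.exp (-t)) (Real.exp_pos _)).comp t he).congr_deriv ?_
  simp only [quad]
  linear_combination (Real.cos (θ (Real.exp (-t)))) ^ 2 * ha t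
    + 2 * Real.sin (θ (Real.exp (-t))) * Real.cos (θ (Real.exp (-t))) * hb t
    + (Real.sin (θ (Real.exp (-t)))) ^ 2 * hd t

/-- The dichotomy in t = -log x: exponential decay in t means smallness at zero, and the lower bound
C exp t is C / x. -/
theorem alternative_at_zero (hP : CoefficientClass μm μp P)
    {u v ρ θ : ℝ → ℝ} (hs : ∀ x, 0 < x → SolvesDirac P lam u v x)
    (hpol : IsPolar (fun x => P x 0 0 - lam) (fun x => P x 0 1) (fun x => P x 1 1 - lam) u v ρ θ) :
    (∃ L, Tendsto θ (𝓝[>] 0) (𝓝 L)) ∧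
      (Tendsto (fun x => u x ^ 2 + v x ^ 2) (𝓝[>] 0) (𝓝 0) ∨
        ∃ C > 0, ∀ᶠ x in 𝓝[>] 0, C * x⁻¹ ≤ u x ^ 2 + v x ^ 2) := by
  obtain ⟨a, b, d, w, A, B, D, hA, hB, hD, hw, hdet, hstrong, ha, hb, hd⟩ :=
    hP.exists_log_coefficients lam
  obtain ⟨L, hL, -, h⟩ := angle_limit_dichotomy hA hB hD hw hdet
    (Eventually.of_forall (SolvesDirac.comp_exp_neg ha hb hd hs))
    (ρ := fun t => ρ (Real.exp (-t))) (φ := fun t => θ (Real.exp (-t)))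
    (Eventually.of_forall fun t => hpol.pos _ (Real.exp_pos _))
    (Eventually.of_forall fun t => hpol.fst_eq _ (Real.exp_pos _))
    (Eventually.of_forall fun t => hpol.snd_eq _ (Real.exp_pos _))
    (Eventually.of_forall (hpol.hasDerivAt_comp_exp_neg ha hb hd))
  refine ⟨⟨L, tendsto_nhdsGT_zero_of_comp_exp_neg hL⟩, ?_⟩
  rcases h with ⟨-, κ, hκ, C, -, h⟩ | ⟨-, -, -, h⟩
  · refine Or.inl (tendsto_nhdsGT_zero_of_comp_exp_neg ?_)
    refine squeeze_zero' (Eventually.of_forall fun t => by positivity) h ?_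
    have := (Real.tendsto_exp_neg_atTop_nhds_zero.comp (tendsto_id.const_mul_atTop hκ)).const_mul C
    simpa using this
  · obtain ⟨C, hC, h⟩ := h hstrong
    refine Or.inr ⟨C, hC, ?_⟩
    filter_upwards [tendsto_neg_log_nhdsGT_zero.eventually h, self_mem_nhdsWithin] with x h1 hx
    rwa [neg_neg, Real.exp_neg, Real.exp_log (mem_Ioi.1 hx)] at h1

/-- Start with the solution equal to (1, 0) at x = 1. If it decays at zero it is the one sought;
otherwise it grows, and a multiple of it is added to the solution equal to (0, 1) at x = 1. -/
theorem exists_small_solution (hP : CoefficientClass μm μp P) (lam : ℝ) :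
    ∃ u v ρ θ : ℝ → ℝ, (∀ x, 0 < x → SolvesDirac P lam u v x) ∧
      IsPolar (fun x => P x 0 0 - lam) (fun x => P x 0 1) (fun x => P x 1 1 - lam) u v ρ θ ∧
      Tendsto u (𝓝[>] 0) (𝓝 0) ∧ Tendsto v (𝓝[>] 0) (𝓝 0) := by
  have hp := hP.continuousOn_sub 0 0 lam
  have hq := hP.continuousOn_apply 0 1
  have hr := hP.continuousOn_sub 1 1 lam
  suffices H : ∃ u v : ℝ → ℝ, (∀ x, 0 < x → SolvesDirac P lam u v x) ∧
      (∃ x, 0 < x ∧ (u x ≠ 0 ∨ v x ≠ 0)) ∧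
      Tendsto u (𝓝[>] 0) (𝓝 0) ∧ Tendsto v (𝓝[>] 0) (𝓝 0) by
    obtain ⟨u, v, hs, hne, h0⟩ := H
    obtain ⟨ρ, θ, hpol⟩ := exists_isPolar hp hq hr hs hne
    exact ⟨u, v, ρ, θ, hs, hpol, h0⟩
  obtain ⟨θ₁, ρ₁, hθ₁, hρ₁, h₁⟩ := exists_polar hp hq hr 0
  obtain ⟨θ₂, ρ₂, hθ₂, hρ₂, h₂⟩ := exists_polar hp hq hr (Real.pi / 2)
  have hs₁ : ∀ x, 0 < x → SolvesDirac P lam (fun x => ρ₁ x * Real.cos (θ₁ x))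
    (fun x => ρ₁ x * Real.sin (θ₁ x)) x := fun x hx => (h₁ x hx).2.2
  have hs₂ : ∀ x, 0 < x → SolvesDirac P lam (fun x => ρ₂ x * Real.cos (θ₂ x))
    (fun x => ρ₂ x * Real.sin (θ₂ x)) x := fun x hx => (h₂ x hx).2.2
  have hpol₁ : IsPolar (fun x => P x 0 0 - lam) (fun x => P x 0 1) (fun x => P x 1 1 - lam)
      (fun x => ρ₁ x * Real.cos (θ₁ x)) (fun x => ρ₁ x * Real.sin (θ₁ x)) ρ₁ θ₁ :=
    ⟨fun x hx => (h₁ x hx).1, fun _ _ => rfl, fun _ _ => rfl, fun x hx => (h₁ x hx).2.1⟩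
  obtain ⟨a, b, d, w, A, B, D, hA, hB, hD, hw, hdet, -, ha, hb, hd⟩ :=
    hP.exists_log_coefficients lam
  have hlog₁ := Eventually.of_forall (f := atTop) (SolvesDirac.comp_exp_neg ha hb hd hs₁)
  obtain ⟨L, hL, -, h⟩ := angle_limit_dichotomy hA hB hD hw hdet hlog₁
    (ρ := fun t => ρ₁ (Real.exp (-t))) (φ := fun t => θ₁ (Real.exp (-t)))
    (Eventually.of_forall fun t => hpol₁.pos _ (Real.exp_pos _))
    (Eventually.of_forall fun t => hpol₁.fst_eq _ (Real.exp_pos _))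
    (Eventually.of_forall fun t => hpol₁.snd_eq _ (Real.exp_pos _))
    (Eventually.of_forall (hpol₁.hasDerivAt_comp_exp_neg ha hb hd))
  rcases h with ⟨-, κ, hκ, C, -, h⟩ | ⟨-, ⟨κ, hκ, hgrow⟩, -, -⟩
  · have hz : Tendsto (fun t => C * Real.exp (-(κ * t))) atTop (𝓝 0) := by
      have := (Real.tendsto_exp_neg_atTop_nhds_zero.comp
        (tendsto_id.const_mul_atTop hκ)).const_mul C
      simpa using this
    refine ⟨_, _, hs₁, ⟨1, one_pos, Or.inl (by simp [hθ₁, hρ₁])⟩,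
      tendsto_nhdsGT_zero_of_comp_exp_neg ?_, tendsto_nhdsGT_zero_of_comp_exp_neg ?_⟩
    · have := squeeze_zero' (Eventually.of_forall fun t => sq_nonneg _)
        (h.mono fun t ht => (le_add_of_nonneg_right (sq_nonneg _)).trans ht) hz
      exact tendsto_zero_of_sq this
    · have := squeeze_zero' (Eventually.of_forall fun t => sq_nonneg _)
        (h.mono fun t ht => (le_add_of_nonneg_left (sq_nonneg _)).trans ht) hz
      exact tendsto_zero_of_sq this
  · have hK : ∀ᶠ t in atTop, |a t| + 2 * |b t| + |d t| ≤ |A| + 2 * |B| + |D| + 1 :=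
      ((hA.abs.add (hB.abs.const_mul 2)).add hD.abs).eventually_le_const (by linarith)
    obtain ⟨ℓ, hu, hv⟩ := exists_tendsto_zero_sub_mul hκ hw hK hlog₁
      (Eventually.of_forall (SolvesDirac.comp_exp_neg ha hb hd hs₂))
      (W := 1)
      (Eventually.of_forall fun t => by
        refine (wronskian_eq hs₁ hs₂ (Real.exp_pos _)).trans ?_
        simp [hθ₁, hθ₂, hρ₁, hρ₂])
      (Eventually.of_forall fun t => hpol₁.normSq_pos (Real.exp_pos _)) hgrow
    refine ⟨fun x => ρ₂ x * Real.cos (θ₂ x) + ℓ * (ρ₁ x * Real.cos (θ₁ x)),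
      fun x => ρ₂ x * Real.sin (θ₂ x) + ℓ * (ρ₁ x * Real.sin (θ₁ x)),
      fun x hx => (hs₁ x hx).add_const_mul (hs₂ x hx) ℓ,
      -- Whatever ℓ is, the second coordinate at x = 1 equals 1, so the combination is nontrivial.
      ⟨1, one_pos, Or.inr (by simp [hθ₁, hθ₂, hρ₁, hρ₂])⟩,
      tendsto_nhdsGT_zero_of_comp_exp_neg hu, tendsto_nhdsGT_zero_of_comp_exp_neg hv⟩

end Alternatives

/-! ### Comparison of angles and the decaying direction -/

/-- Two continuous angles of the same line on `(0, ∞)` differ by a constant multiple of `π`. -/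
theorem exists_int_sub_eq_mul_pi {θ₁ θ₂ : ℝ → ℝ} (h₁ : ContinuousOn θ₁ (Ioi 0))
    (h₂ : ContinuousOn θ₂ (Ioi 0)) (h : ∀ x, 0 < x → Real.sin (θ₂ x - θ₁ x) = 0) :
    ∃ k : ℤ, ∀ x, 0 < x → θ₂ x = θ₁ x + k * Real.pi := by
  have hpi := Real.pi_pos
  -- The difference divided by π is continuous with values in the discrete set of integers.
  obtain ⟨_, ⟨k, rfl⟩, hk⟩ := isPreconnected_Ioi.eqOn_const_of_mapsTo
    (T := range ((↑) : ℤ → ℝ)) (Int.isClosedEmbedding_coe_real.isEmbedding.isDiscrete_range)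
    (f := fun x => (θ₂ x - θ₁ x) / Real.pi) ((h₂.sub h₁).div_const _)
    (fun x hx => by
      obtain ⟨n, hn⟩ := Real.sin_eq_zero_iff.1 (h x hx)
      exact ⟨n, (eq_div_iff hpi.ne').2 hn⟩)
    ⟨0, 0, by simp⟩
  refine ⟨k, fun x hx => ?_⟩
  have := hk (mem_Ioi.2 hx)
  simp only [Function.const] at this
  rw [div_eq_iff hpi.ne'] at this
  linarith

theorem sin_sub_eq_zero_of_proportional {c r₁ r₂ φ₁ φ₂ : ℝ} (hr : r₂ ≠ 0)
    (h0 : r₂ * Real.cos φ₂ = c * (r₁ * Real.cos φ₁))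
    (h1 : r₂ * Real.sin φ₂ = c * (r₁ * Real.sin φ₁)) : Real.sin (φ₂ - φ₁) = 0 := by
  refine (mul_eq_zero.1 ?_).resolve_left hr
  rw [Real.sin_sub]
  linear_combination Real.cos φ₁ * h1 - Real.sin φ₁ * h0

/-- The decaying direction of the limit system at infinity. -/
theorem cross_neg_iff_of_quad_eq_zero {m n L : ℝ} (hm : 0 < m) (hn : 0 < n)
    (hq : quad (-m) 0 n L = 0) :
    cross (-m) 0 n L < 0 ↔
      ∃ k : ℤ, L = Real.pi - Real.arctan (Real.sqrt (m / n)) + k * Real.pi := by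
  have hmn : 0 < m / n := div_pos hm hn
  have hs := Real.sqrt_pos.2 hmn
  have hsq := Real.sq_sqrt hmn.le
  set s := Real.sqrt (m / n) with hsdef
  simp only [quad, cross] at hq ⊢
  have hone := Real.sin_sq_add_cos_sq L
  have hc : Real.cos L ≠ 0 := fun h0 => by
    rw [h0] at hq hone
    nlinarith
  -- The zeros of the form are the directions tan L = ±s. There `cross` equals (n + m) tan L cos² L,
  -- so its sign is that of tan L.
  have htan : Real.tan L ^ 2 = s ^ 2 := by
    rw [hsq, Real.tan_eq_sin_div_cos, div_pow, div_eq_div_iff (pow_ne_zero 2 hc) hn.ne']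
    linarith
  have hsc : Real.sin L * Real.cos L = Real.tan L * Real.cos L ^ 2 := by
    rw [Real.tan_eq_sin_div_cos]
    field_simp
  have hc2 : 0 < Real.cos L ^ 2 := by positivity
  rw [hsc, zero_mul, zero_add, sub_neg_eq_add]
  constructor
  · intro hneg
    have ht : Real.tan L = -s := by
      rcases sq_eq_sq_iff_eq_or_eq_neg.1 htan with h | h
      · rw [h] at hneg
        have : 0 < (n + m) * (s * Real.cos L ^ 2) := by positivity
        linarith
      · exact h
    have hsin : Real.sin (L - -Real.arctan s) = 0 := by
      have e : Real.tan (-Real.arctan s) = -s := by rw [Real.tan_neg, Real.tan_arctan]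
      have hc' : Real.cos (-Real.arctan s) ≠ 0 := by
        rw [Real.cos_neg]
        exact (Real.cos_arctan_pos s).ne'
      rw [Real.tan_eq_sin_div_cos, div_eq_iff hc'] at e
      rw [Real.tan_eq_sin_div_cos, div_eq_iff hc] at ht
      rw [Real.sin_sub, e, ht]
      ring
    obtain ⟨k, hk⟩ := Real.sin_eq_zero_iff.1 hsin
    -- L = -arctan s + kπ; the explicit π in the target accounts for the shift of k.
    refine ⟨k - 1, ?_⟩
    push_cast
    linarith
  · rintro ⟨k, rfl⟩
    rw [Real.tan_add_int_mul_pi, Real.tan_pi_sub, Real.tan_arctan] at *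
    have : 0 < (n + m) * (s * Real.cos (Real.pi - Real.arctan s + k * Real.pi) ^ 2) := by
      positivity
    linarith

/-! ### Uniqueness of the small solution and of its normalized angle -/

section Main

variable {μm μp lam : ℝ} {P : ℝ → Matrix (Fin 2) (Fin 2) ℝ}

theorem SolvesDirac.continuousOn {u v : ℝ → ℝ} (h : ∀ x, 0 < x → SolvesDirac P lam u v x) :
    ContinuousOn u (Ioi 0) ∧ ContinuousOn v (Ioi 0) :=
  ⟨fun x hx => (h x hx).1.continuousAt.continuousWithinAt,
    fun x hx => (h x hx).2.continuousAt.continuousWithinAt⟩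

/-- A solution that is small at zero is a multiple of any nontrivial solution that is small at
zero. -/
theorem exists_eq_const_mul_of_small {u₁ v₁ u₂ v₂ : ℝ → ℝ}
    (h₁ : ∀ x, 0 < x → SolvesDirac P lam u₁ v₁ x) (h₂ : ∀ x, 0 < x → SolvesDirac P lam u₂ v₂ x)
    (hpos : ∀ x, 0 < x → 0 < u₁ x ^ 2 + v₁ x ^ 2)
    (hu₁ : Tendsto u₁ (𝓝[>] 0) (𝓝 0)) (hv₁ : Tendsto v₁ (𝓝[>] 0) (𝓝 0))
    (hu₂ : Tendsto u₂ (𝓝[>] 0) (𝓝 0)) (hv₂ : Tendsto v₂ (𝓝[>] 0) (𝓝 0)) :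
    ∃ c, ∀ x, 0 < x → u₂ x = c * u₁ x ∧ v₂ x = c * v₁ x := by
  have hlim : Tendsto (fun x => u₁ x * v₂ x - u₂ x * v₁ x) (𝓝[>] 0) (𝓝 0) := by
    simpa using (hu₁.mul hv₂).sub (hu₂.mul hv₁)
  have hconst : (fun x => u₁ x * v₂ x - u₂ x * v₁ x) =ᶠ[𝓝[>] 0]
      fun _ => u₁ 1 * v₂ 1 - u₂ 1 * v₁ 1 := by
    filter_upwards [self_mem_nhdsWithin] with x hx using wronskian_eq h₁ h₂ hx
  have h0 := tendsto_nhds_unique (hlim.congr' hconst) tendsto_const_nhds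
  exact exists_eq_const_mul h₁ h₂ hpos fun x hx => by rw [wronskian_eq h₁ h₂ hx, ← h0]

/-- A solution that is small at zero, with an angle normalized at zero. -/
theorem exists_normalized_polar (hP : CoefficientClass μm μp P) (lam : ℝ) :
    ∃ u v ρ θ : ℝ → ℝ, (∀ x, 0 < x → SolvesDirac P lam u v x) ∧
      IsPolar (fun x => P x 0 0 - lam) (fun x => P x 0 1) (fun x => P x 1 1 - lam) u v ρ θ ∧
      Tendsto u (𝓝[>] 0) (𝓝 0) ∧ Tendsto v (𝓝[>] 0) (𝓝 0) ∧
      ∃ θ₀ ∈ Ico 0 Real.pi, Tendsto θ (𝓝[>] 0) (𝓝 θ₀) := by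
  obtain ⟨u, v, ρ, θ, hs, hpol, hu, hv⟩ := exists_small_solution hP lam
  obtain ⟨⟨L, hL⟩, -⟩ := alternative_at_zero hP hs hpol
  obtain ⟨k, hk, -⟩ := existsUnique_add_zsmul_mem_Ico Real.pi_pos L 0
  rw [zero_add, zsmul_eq_mul] at hk
  -- Shifting the angle by kπ multiplies the solution by (-1)^k and keeps ρ. The leading 0 presents
  -- the multiple as the zero solution plus a multiple, as in `SolvesAt.add_const_mul`.
  refine ⟨fun x => 0 + (-1) ^ k * u x, fun x => 0 + (-1) ^ k * v x, ρ,
    fun x => θ x + k * Real.pi, fun x hx => ?_, ⟨hpol.pos, fun x hx => ?_, fun x hx => ?_,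
      fun x hx => ?_⟩, ?_, ?_, L + k * Real.pi, hk, hL.add_const _⟩
  · refine SolvesAt.add_const_mul (u₂ := fun _ => 0) (v₂ := fun _ => 0) (hs x hx) ⟨?_, ?_⟩ _
    · exact (hasDerivAt_const x 0).congr_deriv (by ring)
    · exact (hasDerivAt_const x 0).congr_deriv (by ring)
  · rw [Real.cos_add_int_mul_pi, hpol.fst_eq x hx]
    ring
  · rw [Real.sin_add_int_mul_pi, hpol.snd_eq x hx]
    ring
  · rw [quad_add_int_mul_pi]
    exact (hpol.hasDerivAt x hx).add_const _
  · simpa using hu.const_mul ((-1 : ℝ) ^ k)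
  · simpa using hv.const_mul ((-1 : ℝ) ^ k)

theorem tendsto_plane_zero_iff {z : ℝ → Plane} {l : Filter ℝ} :
    Tendsto z l (𝓝 0) ↔
      Tendsto (fun x => z x 0) l (𝓝 0) ∧ Tendsto (fun x => z x 1) l (𝓝 0) := by
  constructor
  · intro h
    exact ⟨((EuclideanSpace.proj (𝕜 := ℝ) (0 : Fin 2)).continuous.tendsto 0).comp h,
      ((EuclideanSpace.proj (𝕜 := ℝ) (1 : Fin 2)).continuous.tendsto 0).comp h⟩
  · rintro ⟨h0, h1⟩
    refine tendsto_zero_iff_norm_tendsto_zero.2 (tendsto_zero_of_sq ?_)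
    simp only [norm_sq_plane]
    simpa using (h0.pow 2).add (h1.pow 2)

/-- The normalized angle is unique. -/
theorem IsNormalizedAngle.eq_of_isPolar (hP : CoefficientClass μm μp P)
    {u v ρ θ θ' : ℝ → ℝ} {θ₀ : ℝ}
    (hs : ∀ x, 0 < x → SolvesDirac P lam u v x)
    (hpol : IsPolar (fun x => P x 0 0 - lam) (fun x => P x 0 1) (fun x => P x 1 1 - lam) u v ρ θ)
    (hu : Tendsto u (𝓝[>] 0) (𝓝 0)) (hv : Tendsto v (𝓝[>] 0) (𝓝 0))
    (hθ₀ : θ₀ ∈ Ico 0 Real.pi) (hθ : Tendsto θ (𝓝[>] 0) (𝓝 θ₀))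
    (h : IsNormalizedAngle P lam θ') {x : ℝ} (hx : 0 < x) : θ' x = θ x := by
  obtain ⟨z, hz, hang, θ₀', hθ₀', hθ'⟩ := h
  obtain ⟨hz0, hz1⟩ := tendsto_plane_zero_iff.1 hz.small
  obtain ⟨c, hc⟩ := exists_eq_const_mul_of_small hs (fun x hx => hz.solution.solvesDirac hP hx)
    (fun x hx => hpol.normSq_pos hx) hu hv hz0 hz1
  have hc0 : c ≠ 0 := by
    rintro rfl
    obtain ⟨x, hx, hne⟩ := hz.nontrivial
    have := hc x hx
    exact hne (plane_ext (by simpa using this.1) (by simpa using this.2))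
  have hnorm : ∀ x, 0 < x → ‖z x‖ ≠ 0 := fun x hx h0 => by
    have h2 := norm_sq_plane (z x)
    rw [h0, (hc x hx).1, (hc x hx).2] at h2
    have h3 : 0 < c ^ 2 * (u x ^ 2 + v x ^ 2) := mul_pos (by positivity) (hpol.normSq_pos hx)
    linarith
  obtain ⟨k, hk⟩ := exists_int_sub_eq_mul_pi
    (fun x hx => (hpol.hasDerivAt x hx).continuousAt.continuousWithinAt) hang.continuousOn
    (fun x hx => sin_sub_eq_zero_of_proportional (c := c) (r₁ := ρ x) (hnorm x hx)
      (by rw [← hang.fst_eq x hx, (hc x hx).1, hpol.fst_eq x hx])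
      (by rw [← hang.snd_eq x hx, (hc x hx).2, hpol.snd_eq x hx]))
  have hlim : θ₀' = θ₀ + k * Real.pi := by
    refine tendsto_nhds_unique hθ' ((hθ.add_const (k * Real.pi)).congr' ?_)
    filter_upwards [self_mem_nhdsWithin] with x hx using (hk x hx).symm
  -- Both limits at zero lie in [0, π), so they differ by less than π.
  have hk0 : k = 0 := by
    have hpi := Real.pi_pos
    have h1 : (k : ℝ) < 1 := by
      by_contra! h
      nlinarith [hθ₀'.2, hθ₀.1]
    have h2 : (-1 : ℝ) < k := by
      by_contra! h
      nlinarith [hθ₀.2, hθ₀'.1]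
    have h1' : k < 1 := by exact_mod_cast h1
    have h2' : -1 < k := by exact_mod_cast h2
    omega
  rw [hk x hx, hk0]
  simp

end Main

end DiracSystem

/-! ### The eigenvalue criterion -/

open DiracSystem in
theorem theorem3p2 (μm μp : ℝ) (hμ : μm < μp) (P : ℝ → Matrix (Fin 2) (Fin 2) ℝ)
    (hP : DiracSystem.CoefficientClass μm μp P) (lam : ℝ) (hlam : lam ∈ Set.Ioo μm μp) :
    (∃ ν : ℝ, DiracSystem.IsNu P lam ν) ∧
    ∀ ν : ℝ, DiracSystem.IsNu P lam ν →
      (DiracSystem.IsEigenvalue (DiracSystem.A0 P) lam ↔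
        ∃ k : ℤ, ν = Real.pi - Real.arctan (Real.sqrt ((lam - μm) / (μp - lam)))
          + (k : ℝ) * Real.pi) := by
  obtain ⟨u, v, ρ, θ, hs, hpol, hu, hv, θ₀, hθ₀, hθ⟩ := exists_normalized_polar hP lam
  obtain ⟨L, hL, hq, halt⟩ := alternative_at_infinity hP hlam hs hpol
  have hzsol : IsSolution P lam (fun x => !₂[u x, v x]) :=
    isSolution_of_solvesDirac hP fun x hx => hs x hx
  have hz1 : (!₂[u 1, v 1] : Plane) ≠ 0 := fun h0 => by
    have e0 : u 1 = 0 := congrArg (fun w : Plane => w 0) h0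
    have e1 : v 1 = 0 := congrArg (fun w : Plane => w 1) h0
    have := hpol.normSq_pos one_pos
    rw [e0, e1] at this
    norm_num at this
  have hnorm : ∀ x, 0 < x → ‖(!₂[u x, v x] : Plane)‖ = ρ x := fun x hx => by
    rw [← abs_of_pos (hpol.pos x hx), ← abs_of_nonneg (norm_nonneg _), ← sq_eq_sq_iff_abs_eq_abs,
      norm_sq_plane]
    exact hpol.normSq hx
  have hnorm_angle : IsNormalizedAngle P lam θ := by
    refine ⟨fun x => !₂[u x, v x], ⟨hzsol, ⟨1, one_pos, hz1⟩, tendsto_plane_zero_iff.2 ⟨hu, hv⟩⟩,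
      ⟨fun x hx => (hpol.hasDerivAt x hx).continuousAt.continuousWithinAt, fun x hx => ?_,
        fun x hx => ?_⟩, θ₀, hθ₀, hθ⟩
    · rw [hnorm x hx]; exact hpol.fst_eq x hx
    · rw [hnorm x hx]; exact hpol.snd_eq x hx
  have hNu : IsNu P lam L := by
    refine ⟨⟨θ, hnorm_angle⟩, fun θ' hθ' => hL.congr' ?_⟩
    filter_upwards [eventually_gt_atTop 0] with x hx
    exact (hθ'.eq_of_isPolar hP hs hpol hu hv hθ₀ hθ hx).symm
  refine ⟨⟨L, hNu⟩, fun ν hν => ?_⟩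
  obtain rfl : ν = L := tendsto_nhds_unique (hν.2 θ hnorm_angle) hL
  have hm : 0 < lam - μm := sub_pos.2 hlam.1
  have hn : 0 < μp - lam := sub_pos.2 hlam.2
  -- The congruence for ν is exchanged for `cross` < 0 at the limit angle, the case of `halt` in
  -- which the small solution decays.
  rw [← cross_neg_iff_of_quad_eq_zero hm hn (by rwa [neg_sub]), neg_sub, isEigenvalue_A0_iff]
  constructor
  · rintro ⟨z, hz, ⟨x₀, hx₀, hne⟩, hzL⟩
    rw [memLp_plane_iff hz.1.continuousOn] at hzL
    rcases halt with ⟨h, -⟩ | ⟨-, C, hC, hgrow⟩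
    · exact h
    exfalso
    have hzs := fun x (hx : 0 < x) => hz.solvesDirac hP hx
    have hzne : z x₀ 0 ≠ 0 ∨ z x₀ 1 ≠ 0 := by
      by_contra! h0
      exact hne (plane_ext h0.1 h0.2)
    obtain ⟨r, φ, hzpol⟩ := exists_isPolar (hP.continuousOn_sub 0 0 lam)
      (hP.continuousOn_apply 0 1) (hP.continuousOn_sub 1 1 lam) hzs ⟨x₀, hx₀, hzne⟩
    -- Either the eigenfunction is small at zero, hence a multiple of the small solution, whose norm
    -- is bounded below at infinity; or its squared norm dominates C' / x near zero. Both exclude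
    -- square integrability.
    rcases (alternative_at_zero hP hzs hzpol).2 with h0 | ⟨C', hC', h0⟩
    · have hz0 : Tendsto z (𝓝[>] 0) (𝓝 0) := by
        refine tendsto_zero_iff_norm_tendsto_zero.2 (tendsto_zero_of_sq ?_)
        simpa only [norm_sq_plane] using h0
      obtain ⟨hzu, hzv⟩ := tendsto_plane_zero_iff.1 hz0
      obtain ⟨c, hc⟩ := exists_eq_const_mul_of_small hs hzs (fun x hx => hpol.normSq_pos hx)
        hu hv hzu hzv
      have hc0 : c ≠ 0 := by
        rintro rfl
        have := hc x₀ hx₀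
        simp only [zero_mul] at this
        exact hzne.elim (fun h => h this.1) fun h => h this.2
      refine not_integrableOn_of_const_le (C := c ^ 2 * C) (by positivity) ?_ hzL
      filter_upwards [hgrow, eventually_gt_atTop 0] with x h1 hx
      rw [(hc x hx).1, (hc x hx).2, mul_pow, mul_pow, ← mul_add]
      exact mul_le_mul_of_nonneg_left h1 (sq_nonneg c)
    · exact not_integrableOn_of_inv_le hC' h0 hzL
  · intro hcross
    rcases halt with ⟨-, κ, hκ, C, -, hdecay⟩ | ⟨h, -⟩
    · refine ⟨_, hzsol, ⟨1, one_pos, hz1⟩, (memLp_plane_iff hzsol.1.continuousOn).2 ?_⟩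
      obtain ⟨huc, hvc⟩ := SolvesDirac.continuousOn hs
      exact integrableOn_Ioi_of_bound hκ ((huc.pow 2).add (hvc.pow 2))
        ((hu.pow 2).add (hv.pow 2)) (fun x _ => by positivity) hdecay
    · exact absurd hcross (not_lt.2 h.le)
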